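/- Let $n\ge 0$, let $\mathcal{O}_S=\mathbb{C}\{x_1,\dots,x_n\}$ be the local ring of the smooth complex analytic germ $S=(\mathbb{C}^n,0)$, and let $0\neq h\in\mathcal{O}_S$ with $h(0)=0$ be such that $\mathcal{O}_D:=\mathcal{O}_S/\mathcal{O}_S h$ is reduced; that is, $h$ defines a reduced divisor germ $D\subset S$. Let $\Theta_S=\mathrm{Der}_{\mathbb{C}}(\mathcal{O}_S)$, and let \[ \mathrm{Der}(-\log D)=\{\delta\in\Theta_S\mid dh(\delta)=\delta(h)\in\mathcal{O}_S h\}, \] and let $\Omega^1(\log D)$ be the $\mathcal{O}_S$-module of meromorphic $1$-forms $\omega$ on $S$ for which $h\omega$ and $h\,d\omega$ are holomorphic. Let $\mathcal{M}_D$ be the total ring of fractions of $\mathcal{O}_D$. A fractional ideal is a finitely generated $\mathcal{O}_D$-submodule of $\mathcal{M}_D$ that contains a non-zero-divisor; for a fractional ideal $\mathcal{I}$, the dual $\mathcal{I}^\vee=\mathrm{Hom}_{\mathcal{O}_D}(\mathcal{I},\mathcal{O}_D)$ is identified with $\{f\in\mathcal{M}_D\mid f\,\mathcal{I}\subseteq\mathcal{O}_D\}$,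 where $f$ corresponds to multiplication by $f$. Let $\mathcal{J}_D\subseteq\mathcal{O}_D$ be the Jacobian ideal, generated by the restrictions of $\partial h/\partial x_1,\dots,\partial h/\partial x_n$. The residue $\rho_D(\omega)\in\mathcal{M}_D$ of $\omega\in\Omega^1(\log D)$ is $\frac{\xi}{g}\big|_D$ for any representation $\omega=\frac{dh}{h}\frac{\xi}{g}+\frac{\eta}{g}$ with $\xi,g\in\mathcal{O}_S$, $\eta$ a holomorphic $1$-form, and $g$ restricting to a non-zero-divisor of $\mathcal{O}_D$; put $\mathcal{R}_D=\rho_D(\Omega^1(\log D))$. Then such a representation always exists, $\rho_D(\omega)$ does not depend on it, $\rho_D\colon\Omega^1(\log D)\to\mathcal{M}_D$ is $\mathcal{O}_S$-linear, $\mathcal{J}_D$ and $\mathcal{R}_D$ are fractional ideals, the above identifications of their duals hold, and: (a) There is an exact sequence of $\mathcal{O}_S$-modules \[ 0\to\mathrm{Der}(-\log D)\to\Theta_S\xrightarrow{\ \sigma_D\ }\mathcal{R}_D^\vee\to\mathrm{Ext}^1_{\mathcal{O}_S}(\Omega^1(\log D),\mathcal{O}_S)\to 0, \] in which the first map is the inclusion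 and $\sigma_D(\delta)(\rho_D(\omega))=dh(\delta)\cdot\rho_D(\omega)$ for all $\delta\in\Theta_S$ and $\omega\in\Omega^1(\log D)$. (b) In particular, $\sigma_D(\Theta_S)=\mathcal{J}_D$ as fractional ideals. (c) Moreover, $\mathcal{J}_D^\vee=\mathcal{R}_D$ as fractional ideals. -/

import Mathlib

open scoped nonZeroDivisors

noncomputable section

namespace LogResidue

/-! ### The local ring `ℂ{x₁, …, xₙ}` of the smooth germ `S = (ℂⁿ, 0)` -/

/-- A formal power series over `ℂ` is convergent if it converges absolutely on some polydisc
around the origin. -/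
def IsConvergent {n : ℕ} (f : MvPowerSeries (Fin n) ℂ) : Prop :=
  ∃ r : ℝ, 0 < r ∧ Summable fun α : Fin n →₀ ℕ => ‖MvPowerSeries.coeff α f‖ * r ^ α.degree

theorem IsConvergent.exists_le {n : ℕ} {f g : MvPowerSeries (Fin n) ℂ}
    (hf : IsConvergent f) (hg : IsConvergent g) :
    ∃ r : ℝ, 0 < r ∧
      (Summable fun α : Fin n →₀ ℕ => ‖MvPowerSeries.coeff α f‖ * r ^ α.degree) ∧
      (Summable fun α : Fin n →₀ ℕ => ‖MvPowerSeries.coeff α g‖ * r ^ α.degree) := by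
  obtain ⟨r, hr, hf⟩ := hf
  obtain ⟨s, hs, hg⟩ := hg
  refine ⟨min r s, lt_min hr hs, ?_, ?_⟩
  · refine hf.of_nonneg_of_le (fun α => by positivity) fun α => ?_
    gcongr
    exact min_le_left _ _
  · refine hg.of_nonneg_of_le (fun α => by positivity) fun α => ?_
    gcongr
    exact min_le_right _ _

theorem IsConvergent.add {n : ℕ} {f g : MvPowerSeries (Fin n) ℂ}
    (hf : IsConvergent f) (hg : IsConvergent g) : IsConvergent (f + g) := by
  obtain ⟨r, hr, hf, hg⟩ := hf.exists_le hg
  refine ⟨r, hr, (hf.add hg).of_nonneg_of_le (fun α => by positivity) fun α => ?_⟩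
  rw [map_add, ← add_mul]
  gcongr
  exact norm_add_le _ _

theorem summable_of_le_antidiagonal {A : Type*} [AddCommMonoid A] [Finset.HasAntidiagonal A] {a b c : A → ℝ}
    (ha : Summable a) (hb : Summable b) (ha0 : ∀ x, 0 ≤ a x) (hb0 : ∀ x, 0 ≤ b x)
    (hc0 : ∀ x, 0 ≤ c x)
    (h : ∀ x, c x ≤ ∑ p ∈ Finset.HasAntidiagonal.antidiagonal x, a p.1 * b p.2) : Summable c :=
  Summable.of_nonneg_of_le hc0 h
    (summable_sum_mul_antidiagonal_of_summable_mul (ha.mul_of_nonneg hb ha0 hb0))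

theorem IsConvergent.mul {n : ℕ} {f g : MvPowerSeries (Fin n) ℂ}
    (hf : IsConvergent f) (hg : IsConvergent g) : IsConvergent (f * g) := by
  obtain ⟨r, hr, hf, hg⟩ := hf.exists_le hg
  refine ⟨r, hr, summable_of_le_antidiagonal hf hg (fun α => mul_nonneg (norm_nonneg _) (pow_nonneg hr.le _))
      (fun α => mul_nonneg (norm_nonneg _) (pow_nonneg hr.le _))
      (fun α => mul_nonneg (norm_nonneg _) (pow_nonneg hr.le _)) fun α => ?_⟩
  have h1 : ‖MvPowerSeries.coeff α (f * g)‖ ≤ ∑ p ∈ Finset.HasAntidiagonal.antidiagonal α,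
      ‖MvPowerSeries.coeff p.1 f * MvPowerSeries.coeff p.2 g‖ := by
    rw [MvPowerSeries.coeff_mul]
    exact norm_sum_le _ _
  refine (mul_le_mul_of_nonneg_right h1 (pow_nonneg hr.le _)).trans (le_of_eq ?_)
  rw [Finset.sum_mul]
  refine Finset.sum_congr rfl fun p hp => ?_
  have h2 : α.degree = p.1.degree + p.2.degree := by
    rw [← Finset.HasAntidiagonal.mem_antidiagonal.mp hp, map_add]
  rw [h2, pow_add, norm_mul]
  ring

theorem isConvergent_C {n : ℕ} (c : ℂ) :
    IsConvergent (algebraMap ℂ (MvPowerSeries (Fin n) ℂ) c) := by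
  classical
  refine ⟨1, one_pos, summable_of_ne_finset_zero (s := {0}) fun α hα => ?_⟩
  have h0 : α ≠ 0 := by simpa using hα
  simp [MvPowerSeries.algebraMap_apply, MvPowerSeries.coeff_C, h0]

/-- The ring `𝓞_S = ℂ{x₁, …, xₙ}` of convergent power series, as a subalgebra of the ring of
formal power series. -/
def convergentSeries (n : ℕ) : Subalgebra ℂ (MvPowerSeries (Fin n) ℂ) where
  carrier := {f | IsConvergent f}
  mul_mem' := IsConvergent.mul
  add_mem' := IsConvergent.add
  algebraMap_mem' := isConvergent_C

/-- `𝓞_S` for `S = (ℂⁿ, 0)`. -/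
def OS (n : ℕ) : Type := convergentSeries n

instance (n : ℕ) : CommRing (OS n) := inferInstanceAs (CommRing (convergentSeries n))

instance (n : ℕ) : IsDomain (OS n) := 
  haveI : IsDomain (MvPowerSeries (Fin n) ℂ) := NoZeroDivisors.to_isDomain _
  Function.Injective.isDomain (convergentSeries n).val.toRingHom Subtype.val_injective

instance (n : ℕ) : Algebra ℂ (OS n) := inferInstanceAs (Algebra ℂ (convergentSeries n))

/-- The inclusion of `𝓞_S` into the ring of formal power series. -/
def toSeries (n : ℕ) : OS n →ₐ[ℂ] MvPowerSeries (Fin n) ℂ := (convergentSeries n).val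

theorem IsConvergent.pderiv {n : ℕ} (i : Fin n) {f : MvPowerSeries (Fin n) ℂ}
    (hf : IsConvergent f) : IsConvergent (MvPowerSeries.pderiv ℂ i f) := by
  obtain ⟨r, hr, hf⟩ := hf
  refine ⟨r / 2, half_pos hr, ?_⟩
  have hinj : Function.Injective fun α : Fin n →₀ ℕ => α + Finsupp.single i 1 :=
    add_left_injective _
  refine ((hf.comp_injective hinj).mul_right r⁻¹).of_nonneg_of_le
    (fun α => by positivity) fun α => ?_
  have h1 : (α i : ℝ) + 1 ≤ 2 ^ α.degree := by
    have h2 : α i ≤ α.degree := Finsupp.le_degree i α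
    have h3 : α.degree + 1 ≤ 2 ^ α.degree := Nat.lt_two_pow_self
    exact_mod_cast (by omega : α i + 1 ≤ 2 ^ α.degree)
  have h4 : ‖((α i : ℂ) + 1)‖ = (α i : ℝ) + 1 := by
    exact_mod_cast Complex.norm_natCast (α i + 1)
  simp only [Function.comp_apply]
  rw [MvPowerSeries.coeff_pderiv, norm_mul, h4, map_add, Finsupp.degree_single, pow_succ, div_pow]
  calc _ ≤ ‖MvPowerSeries.coeff (α + Finsupp.single i 1) f‖ * 2 ^ α.degree *
        (r ^ α.degree / 2 ^ α.degree) := by gcongr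
    _ = _ := by field_simp

/-- The partial derivative `∂/∂xᵢ` on `𝓞_S`. -/
def partialD {n : ℕ} (i : Fin n) : Derivation ℂ (OS n) (OS n) :=
  Derivation.mk'
    { toFun := fun f => ⟨MvPowerSeries.pderiv ℂ i f.1, IsConvergent.pderiv i f.2⟩
      map_add' := fun f g => Subtype.ext (map_add (MvPowerSeries.pderiv ℂ i) f.1 g.1)
      map_smul' := fun c f => Subtype.ext ((MvPowerSeries.pderiv ℂ i).map_smul c f.1) }
    (fun f g => Subtype.ext ((MvPowerSeries.pderiv ℂ i).leibniz f.1 g.1))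

/-- The module `Θ_S = Der_ℂ(𝓞_S)` of vector fields; for `δ ∈ Θ_S` one has `dh(δ) = δ h`. -/
abbrev Theta (n : ℕ) : Type := Derivation ℂ (OS n) (OS n)

/-! ### Meromorphic forms -/

/-- The field of germs of meromorphic functions on `S`. -/
abbrev MS (n : ℕ) : Type := FractionRing (OS n)

section Extension

variable {A : Type} [CommRing A] [Algebra ℂ A] (D : Derivation ℂ A A)

/-- `a ↦ a + ε D(a)`. -/
def dualHom : A →+* TrivSqZeroExt (FractionRing A) (FractionRing A) where
  toFun a := (algebraMap A (FractionRing A) a, algebraMap A (FractionRing A) (D a))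
  map_one' := TrivSqZeroExt.ext (map_one _) (by
    change algebraMap A (FractionRing A) (D 1) = 0
    simp)
  map_mul' a b := TrivSqZeroExt.ext (map_mul _ a b) (by
    change algebraMap A (FractionRing A) (D (a * b)) =
      algebraMap A (FractionRing A) a * algebraMap A (FractionRing A) (D b) +
        algebraMap A (FractionRing A) (D a) * algebraMap A (FractionRing A) b
    rw [D.leibniz, smul_eq_mul, smul_eq_mul, map_add, map_mul, map_mul]
    ring)
  map_zero' := TrivSqZeroExt.ext (map_zero _) (by
    change algebraMap A (FractionRing A) (D 0) = 0
    simp)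
  map_add' a b := TrivSqZeroExt.ext (map_add _ a b) (by
    change algebraMap A (FractionRing A) (D (a + b)) =
      algebraMap A (FractionRing A) (D a) + algebraMap A (FractionRing A) (D b)
    rw [map_add, map_add])

theorem fst_dualHom (a : A) : (dualHom D a).fst = algebraMap A (FractionRing A) a := rfl

theorem snd_dualHom (a : A) : (dualHom D a).snd = algebraMap A (FractionRing A) (D a) := rfl

theorem dualHom_isUnit (s : A⁰) : IsUnit (dualHom D s) := by
  rw [TrivSqZeroExt.isUnit_iff_isUnit_fst, fst_dualHom]
  exact IsLocalization.map_units (FractionRing A) s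

/-- The extension of `a ↦ a + ε D(a)` to the ring of fractions. -/
def dualLift : FractionRing A →+* TrivSqZeroExt (FractionRing A) (FractionRing A) :=
  IsLocalization.lift (M := A⁰) (dualHom_isUnit D)

theorem dualLift_algebraMap (a : A) :
    dualLift D (algebraMap A (FractionRing A) a) = dualHom D a :=
  IsLocalization.lift_eq _ _

theorem fst_dualLift (q : FractionRing A) : (dualLift D q).fst = q := by
  have h : ((TrivSqZeroExt.fstHom (FractionRing A) (FractionRing A) (FractionRing A)).toRingHom.comp (dualLift D)) =
      RingHom.id (FractionRing A) := by
    refine IsLocalization.ringHom_ext A⁰ (RingHom.ext fun a => ?_)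
    simp [dualLift_algebraMap, fst_dualHom]
  exact DFunLike.congr_fun h q

/-- The unique extension (by the quotient rule) of a derivation to the total
ring of fractions. -/
def extendDer : Derivation ℂ (FractionRing A) (FractionRing A) :=
  Derivation.mk'
    { toFun := fun q => (dualLift D q).snd
      map_add' := fun p q => by simp
      map_smul' := fun c q => by
        have h : c • q = algebraMap A (FractionRing A) (algebraMap ℂ A c) * q := by
          rw [Algebra.smul_def, IsScalarTower.algebraMap_apply ℂ A (FractionRing A)]
        rw [h, map_mul, dualLift_algebraMap]
        simp [fst_dualHom, snd_dualHom, Algebra.smul_def, IsScalarTower.algebraMap_apply ℂ A (FractionRing A)] }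
    (fun p q => by
      simp [fst_dualLift, mul_comm])

theorem extendDer_algebraMap (a : A) :
    extendDer D (algebraMap A (FractionRing A) a) = algebraMap A (FractionRing A) (D a) := by
  change (dualLift D _).snd = _
  rw [dualLift_algebraMap, snd_dualHom]

end Extension

/-- Meromorphic `1`-forms `∑ ωᵢ dxᵢ`, written as the tuple of their coefficients. -/
abbrev MeroForm (n : ℕ) : Type := Fin n → MS n

/-- The coefficient of `dxᵢ ∧ dxⱼ` in the exterior derivative of `ω = ∑ ωᵢ dxᵢ`. -/
def extD {n : ℕ} (ω : MeroForm n) (i j : Fin n) : MS n :=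
  extendDer (partialD i) (ω j) - extendDer (partialD j) (ω i)

/-- A meromorphic function is holomorphic. -/
abbrev IsHol {n : ℕ} (q : MS n) : Prop := q ∈ (algebraMap (OS n) (MS n)).range

/-- `Ω¹(log D)` for `D = {h = 0}`: the meromorphic `1`-forms `ω` such that `h ω` and `h dω` are
holomorphic. -/
def logForms {n : ℕ} (h : OS n) : Submodule (OS n) (MeroForm n) where
  carrier := {ω | (∀ i, IsHol (algebraMap (OS n) (MS n) h * ω i)) ∧
    ∀ i j, IsHol (algebraMap (OS n) (MS n) h * extD ω i j)}
  zero_mem' := by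
    refine ⟨fun i => ?_, fun i j => ?_⟩
    · simp
    · simp [extD]
  add_mem' := by
    intro a b ha hb
    refine ⟨fun i => ?_, fun i j => ?_⟩
    · have := add_mem (ha.1 i) (hb.1 i)
      rwa [← mul_add] at this
    · have := add_mem (ha.2 i j) (hb.2 i j)
      rw [← mul_add] at this
      convert this using 2
      simp only [extD, Pi.add_apply, map_add]
      ring
  smul_mem' := by
    intro f ω hω
    refine ⟨fun i => ?_, fun i j => ?_⟩
    · have := mul_mem (⟨f, rfl⟩ : IsHol (algebraMap (OS n) (MS n) f)) (hω.1 i)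
      convert this using 1
      simp only [Pi.smul_apply, Algebra.smul_def]
      ring
    · have h1 := mul_mem (⟨f, rfl⟩ : IsHol (algebraMap (OS n) (MS n) f)) (hω.2 i j)
      have h2 := mul_mem (⟨_, rfl⟩ : IsHol (algebraMap (OS n) (MS n) (partialD i f))) (hω.1 j)
      have h3 := mul_mem (⟨_, rfl⟩ : IsHol (algebraMap (OS n) (MS n) (partialD j f))) (hω.1 i)
      convert sub_mem (add_mem h1 h2) h3 using 1
      simp only [extD, Pi.smul_apply, Algebra.smul_def (R := OS n) (A := MS n),
        Derivation.leibniz, extendDer_algebraMap]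
      simp only [smul_eq_mul]
      ring

/-- `Der(-log D)`: the vector fields `δ` with `dh(δ) = δ h ∈ 𝓞_S · h`. -/
def logDer {n : ℕ} (h : OS n) : Submodule (OS n) (Theta n) where
  carrier := {δ | δ h ∈ Ideal.span {h}}
  zero_mem' := by simp
  add_mem' := by
    intro a b ha hb
    simpa using add_mem ha hb
  smul_mem' := by
    intro f δ hδ
    simpa using Ideal.mul_mem_left _ f hδ

/-! ### The divisor `D` and fractional ideals on it -/

/-- `𝓞_D = 𝓞_S / 𝓞_S h`. -/
abbrev OD {n : ℕ} (h : OS n) : Type := OS n ⧸ Ideal.span {h}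

/-- The restriction map `𝓞_S → 𝓞_D`. -/
abbrev restr {n : ℕ} (h : OS n) : OS n →+* OD h := Ideal.Quotient.mk (Ideal.span {h})

/-- `𝓜_D`, the total ring of fractions of `𝓞_D`. -/
abbrev MD {n : ℕ} (h : OS n) : Type := FractionRing (OD h)

/-- A fractional ideal over `A`: a finite `A`-submodule of the total ring of fractions which contains a
non-zero-divisor. -/
def IsFracIdeal {A : Type} [CommRing A] (I : Submodule A (FractionRing A)) : Prop :=
  I.FG ∧ ∃ x ∈ I, x ∈ (FractionRing A)⁰

/-- The dual `I^∨ = {f ∈ Q(A) | f · I ⊆ A}`. -/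
def fracDual {A : Type} [CommRing A] (I : Submodule A (FractionRing A)) : Submodule A (FractionRing A) :=
  1 / I

theorem fracDual_mul {A : Type} [CommRing A] {I : Submodule A (FractionRing A)}
    (f : fracDual I) (x : I) : ∃ a : A, algebraMap A (FractionRing A) a = f.1 * x.1 := by
  have := Submodule.mem_div_iff_forall_mul_mem.mp f.2 x.1 x.2
  exact Submodule.mem_one.mp this

theorem algebraMap_injective (A : Type) [CommRing A] :
    Function.Injective (algebraMap A (FractionRing A)) :=
  IsFractionRing.injective A (FractionRing A)

/-- The canonical map from `{f ∈ Q(A) | f · I ⊆ A}` to `Hom_{A}(I, A)`, which sends `f` to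
the multiplication by `f`. -/
def mulHom {A : Type} [CommRing A] (I : Submodule A (FractionRing A)) :
    fracDual I →ₗ[A] (I →ₗ[A] A) where
  toFun f :=
    { toFun := fun x => (fracDual_mul f x).choose
      map_add' := fun x y => algebraMap_injective A (by
        rw [map_add, (fracDual_mul f (x + y)).choose_spec, (fracDual_mul f x).choose_spec,
          (fracDual_mul f y).choose_spec]
        simp [mul_add])
      map_smul' := fun c x => algebraMap_injective A (by
        rw [RingHom.id_apply, smul_eq_mul, map_mul, (fracDual_mul f (c • x)).choose_spec,
          (fracDual_mul f x).choose_spec]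
        simp only [Submodule.coe_smul, Algebra.smul_def]
        ring) }
  map_add' f g := LinearMap.ext fun x => algebraMap_injective A (by
    simp only [LinearMap.coe_mk, AddHom.coe_mk, LinearMap.add_apply, map_add]
    rw [(fracDual_mul (f + g) x).choose_spec, (fracDual_mul f x).choose_spec,
      (fracDual_mul g x).choose_spec]
    simp [add_mul])
  map_smul' c f := LinearMap.ext fun x => algebraMap_injective A (by
    simp only [LinearMap.coe_mk, AddHom.coe_mk, LinearMap.smul_apply, RingHom.id_apply,
      smul_eq_mul, map_mul]
    rw [(fracDual_mul (c • f) x).choose_spec, (fracDual_mul f x).choose_spec]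
    simp only [Submodule.coe_smul, Algebra.smul_def]
    ring)

theorem algebraMap_mulHom {A : Type} [CommRing A] (I : Submodule A (FractionRing A))
    (f : fracDual I) (x : I) :
    algebraMap A (FractionRing A) (mulHom I f x) = f.1 * x.1 :=
  (fracDual_mul f x).choose_spec

/-- The Jacobian ideal `𝓙_D ⊆ 𝓞_D`, generated by the restrictions of the partial derivatives
of `h`. -/
def jacobianIdeal {n : ℕ} (h : OS n) : Ideal (OD h) :=
  Ideal.span (Set.range fun i : Fin n => restr h (partialD i h))

/-- The Jacobian ideal as an `𝓞_D`-submodule of `𝓜_D`. -/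
def jacobianFrac {n : ℕ} (h : OS n) : Submodule (OD h) (MD h) :=
  IsLocalization.coeSubmodule (MD h) (jacobianIdeal h)

/-! ### The logarithmic residue -/

/-- `r ∈ 𝓜_D` is a residue of the meromorphic `1`-form `ω`: there are holomorphic functions `ξ`, `g`
and a holomorphic `1`-form `η` such that `g` restricts to a non-zero-divisor of `𝓞_D`,
`ω = (dh / h) · (ξ / g) + η / g` (here with the denominators `h` and `g` cleared), and `r` is the
restriction of `ξ / g` to `D`. -/
def IsResidue {n : ℕ} (h : OS n) (ω : MeroForm n) (r : MD h) : Prop :=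
  ∃ (ξ g : OS n) (η : Fin n → OS n) (hg : restr h g ∈ (OD h)⁰),
    (∀ i, algebraMap (OS n) (MS n) (h * g) * ω i =
      algebraMap (OS n) (MS n) (ξ * partialD i h + h * η i)) ∧
    r = IsLocalization.mk' (MD h) (restr h ξ) (⟨restr h g, hg⟩ : (OD h)⁰)

/-- `𝓡_D`, the set of residues of logarithmic `1`-forms, as an `𝓞_D`-submodule of `𝓜_D`. -/
def residueModule {n : ℕ} (h : OS n) : Submodule (OD h) (MD h) where
  carrier := {r | ∃ ω ∈ logForms h, IsResidue h ω r}
  zero_mem' := by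
    refine ⟨0, zero_mem _, 0, 1, 0, ?_, ?_, ?_⟩
    · rw [map_one]
      exact one_mem _
    · simp
    · simp [IsLocalization.mk'_zero]
  add_mem' := by
    rintro _ _ ⟨ω, hω, ξ, g, η, hg, e, rfl⟩ ⟨ω', hω', ξ', g', η', hg', e', rfl⟩
    refine ⟨ω + ω', add_mem hω hω', ξ * g' + ξ' * g, g * g', fun i => η i * g' + η' i * g,
      ?_, fun i => ?_, ?_⟩
    · rw [map_mul]
      exact mul_mem hg hg'
    · have h1 := e i
      have h2 := e' i
      simp only [map_mul, map_add, Pi.add_apply] at h1 h2 ⊢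
      linear_combination algebraMap (OS n) (MS n) g' * h1 + algebraMap (OS n) (MS n) g * h2
    · rw [← IsLocalization.mk'_add]
      congr 1
  smul_mem' := by
    rintro c _ ⟨ω, hω, ξ, g, η, hg, e, rfl⟩
    obtain ⟨a, rfl⟩ := Ideal.Quotient.mk_surjective c
    refine ⟨a • ω, Submodule.smul_mem _ a hω, a * ξ, g, fun i => a * η i, hg, fun i => ?_, ?_⟩
    · have h1 := e i
      simp only [map_mul, map_add, Pi.smul_apply,
        Algebra.smul_def (R := OS n) (A := MS n)] at h1 ⊢
      linear_combination algebraMap (OS n) (MS n) a * h1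
    · rw [map_mul, IsLocalization.smul_mk']

end LogResidue

end

open LogResidue

/-! Write a logarithmic form as `ω = a / h` with `a` holomorphic. Since `h dω = da - dh ∧ ω`, being
logarithmic means `∂ᵢh · aⱼ = ∂ⱼh · aᵢ` on `D`, and a residue of `ω` is precisely an `r` with `∂ⱼh ·
r = aⱼ` on `D` for all `j` (`isResidue_iff`). If some `∑ cᵢ ∂ᵢh` is a non-zero-divisor on `D`, then
`r = ∑ cᵢ aᵢ / ∑ cᵢ ∂ᵢh` is the only solution. Conversely, if `f · 𝓙_D ⊆ 𝓞_D`, then lifts `aⱼ` of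
`∂ⱼh · f` are the numerators of a logarithmic form with residue `f`. This is `𝓙_D^∨ = 𝓡_D`.

For the exact sequence, apply `Hom(Ω¹(log D), -)` to `0 → 𝓞_S → 𝓞_S → 𝓞_D → 0`. Multiplication by
`h` on `Ω¹(log D)` factors through the free module of holomorphic forms, so `h` annihilates `Ext¹`
and the connecting map is onto; its kernel consists of the maps that lift to `𝓞_S`. The kernel of
the residue map is the module of holomorphic forms, so `𝓡_D^∨` consists of the maps `Ω¹(log D) →
𝓞_D` that vanish on these. Every map to `𝓞_D` differs from such a map by a liftable one
(`exists_hom_restr_holForm_eq`), and the liftable maps in `𝓡_D^∨` are those given by vector fields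
(`exact_dualMap_connecting`).

The non-zero-divisor in `𝓙_D` comes from reducedness: if `𝓙_D` lay in a minimal prime, the preimage
of that prime in `𝓞_S` would be a nonzero proper ideal stable under all `∂ᵢ`, which cannot exist.
Prime avoidance then needs `𝓞_S` to be Noetherian. Noetherianity, the unit criterion and the
description of derivations all rest on a division theorem for convergent series, proved by a
contraction argument in weighted `ℓ¹`-norms. -/

open scoped nonZeroDivisors

noncomputable section

namespace LogResidue

open scoped ENNReal
open Filter Topology

/-! ### Weighted norms on power series -/

section Norm

variable {n : ℕ}

/-- The weight `∏ pᵢ ^ αᵢ` of an exponent `α`, where `pᵢ` is the `i`-th prime. It turns sums into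
products and is injective, so it induces a monomial order. -/
def primeWeight (α : Fin n →₀ ℕ) : ℕ := ∏ i : Fin n, Nat.nth Nat.Prime i ^ α i

theorem primeWeight_add (α β : Fin n →₀ ℕ) :
    primeWeight (α + β) = primeWeight α * primeWeight β := by
  simp [primeWeight, pow_add, Finset.prod_mul_distrib]

theorem primeWeight_zero : primeWeight (0 : Fin n →₀ ℕ) = 1 := by
  simp [primeWeight]

theorem primeWeight_pos (α : Fin n →₀ ℕ) : 0 < primeWeight α :=
  Finset.prod_pos fun _ _ => pow_pos (Nat.prime_nth_prime _).pos _

theorem factorization_primeWeight (α : Fin n →₀ ℕ) (i : Fin n) :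
    (primeWeight α).factorization (Nat.nth Nat.Prime i) = α i := by
  classical
  rw [primeWeight, Nat.factorization_prod_apply
    (fun j _ => pow_ne_zero _ (Nat.prime_nth_prime _).ne_zero)]
  rw [Finset.sum_eq_single i]
  · rw [Nat.Prime.factorization_pow (Nat.prime_nth_prime _), Finsupp.single_eq_same]
  · intro j _ hj
    rw [Nat.Prime.factorization_pow (Nat.prime_nth_prime _), Finsupp.single_apply, if_neg]
    intro h
    exact hj (Fin.ext (Nat.nth_injective Nat.infinite_setOfPred_prime h))
  · simp

theorem primeWeight_injective : Function.Injective (primeWeight (n := n)) := fun α β h =>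
  Finsupp.ext fun i => by rw [← factorization_primeWeight, h, factorization_primeWeight]

theorem two_pow_degree_le_primeWeight (α : Fin n →₀ ℕ) : 2 ^ α.degree ≤ primeWeight α := by
  rw [Finsupp.degree_eq_sum, ← Finset.prod_pow_eq_pow_sum]
  exact Finset.prod_le_prod' fun i _ => Nat.pow_le_pow_left (Nat.prime_nth_prime _).two_le _

theorem primeWeight_le_pow_degree (α : Fin n →₀ ℕ) :
    primeWeight α ≤ Nat.nth Nat.Prime n ^ α.degree := by
  rw [Finsupp.degree_eq_sum, ← Finset.prod_pow_eq_pow_sum]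
  exact Finset.prod_le_prod' fun i _ => Nat.pow_le_pow_left
    (Nat.nth_monotone Nat.infinite_setOfPred_prime i.2.le) _

/-- The weight `(∏ pᵢ ^ αᵢ) ^ (-s)`. -/
def wt (s : ℕ) (α : Fin n →₀ ℕ) : ℝ≥0∞ := ((primeWeight α : ℝ≥0∞)⁻¹) ^ s

theorem wt_add (s : ℕ) (α β : Fin n →₀ ℕ) : wt s (α + β) = wt s α * wt s β := by
  rw [wt, wt, wt, primeWeight_add, Nat.cast_mul, ENNReal.mul_inv (by simp) (by simp), mul_pow]

theorem wt_ne_zero (s : ℕ) (α : Fin n →₀ ℕ) : wt s α ≠ 0 := by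
  simp [wt]

theorem inv_primeWeight_le_one (α : Fin n →₀ ℕ) : ((primeWeight α : ℝ≥0∞)⁻¹) ≤ 1 := by
  rw [ENNReal.inv_le_one]
  exact_mod_cast primeWeight_pos α

theorem wt_antitone (α : Fin n →₀ ℕ) : Antitone fun s => wt s α :=
  fun _ _ h => pow_le_pow_right_of_le_one' (inv_primeWeight_le_one α) h

/-- The weighted `ℓ¹`-norm `∑ |f_α| (∏ pᵢ ^ αᵢ) ^ (-s)`. -/
def wnorm (s : ℕ) (f : MvPowerSeries (Fin n) ℂ) : ℝ≥0∞ :=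
  ∑' α, ‖MvPowerSeries.coeff α f‖ₑ * wt s α

theorem wnorm_antitone (f : MvPowerSeries (Fin n) ℂ) : Antitone fun s => wnorm s f :=
  fun _ _ h => ENNReal.tsum_le_tsum fun α => by
    gcongr
    exact wt_antitone α h

theorem enorm_coeff_mul_wt_le (s : ℕ) (f : MvPowerSeries (Fin n) ℂ) (α : Fin n →₀ ℕ) :
    ‖MvPowerSeries.coeff α f‖ₑ * wt s α ≤ wnorm s f :=
  ENNReal.le_tsum α

theorem wnorm_zero (s : ℕ) : wnorm s (0 : MvPowerSeries (Fin n) ℂ) = 0 := by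
  simp [wnorm]

theorem wnorm_neg (s : ℕ) (f : MvPowerSeries (Fin n) ℂ) : wnorm s (-f) = wnorm s f := by
  simp [wnorm]

theorem wnorm_add_le (s : ℕ) (f g : MvPowerSeries (Fin n) ℂ) :
    wnorm s (f + g) ≤ wnorm s f + wnorm s g := by
  rw [wnorm, wnorm, wnorm, ← ENNReal.tsum_add]
  refine ENNReal.tsum_le_tsum fun α => ?_
  rw [← add_mul, map_add]
  gcongr
  exact enorm_add_le _ _

theorem wnorm_sum_le {ι : Type*} (s : ℕ) (t : Finset ι) (f : ι → MvPowerSeries (Fin n) ℂ) :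
    wnorm s (∑ i ∈ t, f i) ≤ ∑ i ∈ t, wnorm s (f i) :=
  Finset.le_sum_of_subadditive (wnorm s) (wnorm_zero s).le (wnorm_add_le s) t f

theorem wnorm_mul_le (s : ℕ) (f g : MvPowerSeries (Fin n) ℂ) :
    wnorm s (f * g) ≤ wnorm s f * wnorm s g := by
  classical
  have h1 : ∀ α, ‖MvPowerSeries.coeff α (f * g)‖ₑ * wt s α ≤
      ∑ p ∈ Finset.HasAntidiagonal.antidiagonal α, (‖MvPowerSeries.coeff p.1 f‖ₑ * wt s p.1) *
        (‖MvPowerSeries.coeff p.2 g‖ₑ * wt s p.2) := fun α => by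
    rw [MvPowerSeries.coeff_mul]
    refine (mul_le_mul_left (enorm_sum_le _ _) _).trans (le_of_eq ?_)
    rw [Finset.sum_mul]
    refine Finset.sum_congr rfl fun p hp => ?_
    rw [← Finset.HasAntidiagonal.mem_antidiagonal.mp hp, wt_add, enorm_mul]
    ring
  refine (ENNReal.tsum_le_tsum h1).trans (le_of_eq ?_)
  rw [wnorm, wnorm, ← ENNReal.tsum_mul_right]
  simp_rw [← ENNReal.tsum_mul_left]
  rw [← ENNReal.tsum_prod (f := fun a b => ‖MvPowerSeries.coeff a f‖ₑ * wt s a *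
        (‖MvPowerSeries.coeff b g‖ₑ * wt s b)),
    ← Finset.HasAntidiagonal.sigmaAntidiagonalEquivProd.tsum_eq, ENNReal.tsum_sigma']
  refine tsum_congr fun α => ?_
  rw [tsum_fintype, Finset.univ_eq_attach, ← Finset.sum_attach]
  rfl

/-- The bounds `2 ^ |α| ≤ primeWeight α ≤ p ^ |α|` sandwich these weights between powers of polydisc
radii; increasing `s` shrinks the polydisc. -/
theorem isConvergent_iff_wnorm_ne_top (f : MvPowerSeries (Fin n) ℂ) :
    IsConvergent f ↔ ∃ s, wnorm s f ≠ ⊤ := by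
  have key : ∀ r : ℝ, 0 ≤ r → ((Summable fun α : Fin n →₀ ℕ =>
      ‖MvPowerSeries.coeff α f‖ * r ^ α.degree) ↔
      ∑' α : Fin n →₀ ℕ, ‖MvPowerSeries.coeff α f‖ₑ * ENNReal.ofReal r ^ α.degree ≠ ⊤) := by
    intro r hr
    have h1 : ∀ α : Fin n →₀ ℕ, ‖MvPowerSeries.coeff α f‖ₑ * ENNReal.ofReal r ^ α.degree =
        ((‖MvPowerSeries.coeff α f‖₊ * r.toNNReal ^ α.degree : NNReal) : ℝ≥0∞) := fun α => by
      push_cast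
      rfl
    simp_rw [h1]
    rw [ENNReal.tsum_coe_ne_top_iff_summable, ← NNReal.summable_coe]
    simp [Real.coe_toNNReal r hr]
  constructor
  · rintro ⟨r, hr, hf⟩
    obtain ⟨s, hs⟩ := exists_pow_lt_of_lt_one hr (by norm_num : (2 : ℝ)⁻¹ < 1)
    refine ⟨s, ne_top_of_le_ne_top ((key r hr.le).mp hf) (ENNReal.tsum_le_tsum fun α => ?_)⟩
    gcongr
    have h2 : ((2 : ℝ≥0∞)⁻¹) ^ s ≤ ENNReal.ofReal r := by
      have : ((2 : ℝ≥0∞)⁻¹) ^ s = ENNReal.ofReal (2⁻¹ ^ s) := by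
        rw [ENNReal.ofReal_pow (by norm_num), ENNReal.ofReal_inv_of_pos (by norm_num)]
        simp
      rw [this]
      exact ENNReal.ofReal_le_ofReal hs.le
    refine le_trans ?_ (pow_le_pow_left' h2 _)
    rw [← pow_mul, mul_comm s, pow_mul, wt]
    gcongr
    rw [← ENNReal.inv_pow]
    gcongr
    exact_mod_cast two_pow_degree_le_primeWeight α
  · rintro ⟨s, hs⟩
    have hP : (0 : ℝ) < Nat.nth Nat.Prime n := by exact_mod_cast (Nat.prime_nth_prime n).pos
    refine ⟨((Nat.nth Nat.Prime n : ℝ)⁻¹) ^ s, by positivity, (key _ (by positivity)).mpr ?_⟩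
    refine ne_top_of_le_ne_top hs (ENNReal.tsum_le_tsum fun α => ?_)
    gcongr
    rw [ENNReal.ofReal_pow (by positivity), ENNReal.ofReal_inv_of_pos hP, ENNReal.ofReal_natCast,
      ← pow_mul, mul_comm s, pow_mul, wt]
    gcongr
    rw [← ENNReal.inv_pow]
    gcongr
    exact_mod_cast primeWeight_le_pow_degree α

/-- If all exponents of `f` have larger weight than `α`, then the norm of `f` becomes small in
comparison with that of `x ^ α`. -/
theorem eventually_wnorm_le {f : MvPowerSeries (Fin n) ℂ} (hf : IsConvergent f)
    {α : Fin n →₀ ℕ} (hα : ∀ β, MvPowerSeries.coeff β f ≠ 0 → primeWeight α < primeWeight β)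
    {ε : ℝ≥0∞} (hε : ε ≠ 0) : ∀ᶠ s in atTop, wnorm s f ≤ ε * wt s α := by
  obtain ⟨s₀, hs₀⟩ := (isConvergent_iff_wnorm_ne_top f).mp hf
  set a : ℝ≥0∞ := (primeWeight α : ℝ≥0∞) with ha
  have ha0 : a ≠ 0 := by simp [ha, (primeWeight_pos α).ne']
  have hat : a ≠ ⊤ := by simp [ha]
  have hle : ∀ k, wnorm (s₀ + k) f ≤ ((a + 1)⁻¹) ^ k * wnorm s₀ f := fun k => by
    rw [wnorm, wnorm, ← ENNReal.tsum_mul_left]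
    refine ENNReal.tsum_le_tsum fun β => ?_
    by_cases h0 : MvPowerSeries.coeff β f = 0
    · simp [h0]
    · rw [wt, pow_add, ← wt]
      -- Weights are integers, so a larger weight is at least `a + 1`; this gap is uniform in `β`.
      have : ((primeWeight β : ℝ≥0∞)⁻¹) ≤ (a + 1)⁻¹ := by
        gcongr
        rw [ha]
        exact_mod_cast hα β h0
      calc _ = ((primeWeight β : ℝ≥0∞)⁻¹) ^ k * (‖MvPowerSeries.coeff β f‖ₑ * wt s₀ β) := by ring
        _ ≤ _ := by gcongr
  -- Relative to `a⁻¹ ^ s`, the norm decays at least like the geometric sequence with ratio `a / (a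
  -- + 1) < 1`.
  have hlim : Tendsto (fun k => (a * (a + 1)⁻¹) ^ k * (a ^ s₀ * wnorm s₀ f)) atTop (𝓝 0) := by
    have h1 : a * (a + 1)⁻¹ < 1 := by
      rw [← div_eq_mul_inv]
      exact ENNReal.div_lt_of_lt_mul' (by simpa using ENNReal.lt_add_right hat one_ne_zero)
    have := ENNReal.Tendsto.mul_const (b := a ^ s₀ * wnorm s₀ f)
      (ENNReal.tendsto_pow_atTop_nhds_zero_of_lt_one h1)
      (Or.inr (ENNReal.mul_ne_top (ENNReal.pow_ne_top hat) hs₀))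
    simpa using this
  have hev := (tendsto_order.mp hlim).2 ε (pos_iff_ne_zero.mpr hε)
  obtain ⟨K, hK⟩ := eventually_atTop.mp hev
  refine eventually_atTop.mpr ⟨s₀ + K, fun s hs => ?_⟩
  obtain ⟨k, rfl⟩ : ∃ k, s = s₀ + k := ⟨s - s₀, by omega⟩
  refine (hle k).trans ?_
  have h2 := (hK k (by omega)).le
  have h3 : a ^ (s₀ + k) * (a⁻¹) ^ (s₀ + k) = 1 := by
    rw [← mul_pow, ENNReal.mul_inv_cancel ha0 hat, one_pow]
  calc ((a + 1)⁻¹) ^ k * wnorm s₀ f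
      = ((a + 1)⁻¹) ^ k * wnorm s₀ f * (a ^ (s₀ + k) * (a⁻¹) ^ (s₀ + k)) := by rw [h3, mul_one]
    _ = ((a * (a + 1)⁻¹) ^ k * (a ^ s₀ * wnorm s₀ f)) * (a⁻¹) ^ (s₀ + k) := by
      rw [mul_pow, pow_add]; ring
    _ ≤ ε * wt (s₀ + k) α := by rw [wt]; gcongr

end Norm

/-! ### Division of convergent power series -/

section Division

variable {n : ℕ} {ι : Type}

/-- The part of `u` with exponents `β` such that `idx β = some i`, divided by `x ^ (α i)`. -/
def quotPart (α : ι → Fin n →₀ ℕ) (idx : (Fin n →₀ ℕ) → Option ι) (i : ι)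
    (u : MvPowerSeries (Fin n) ℂ) : MvPowerSeries (Fin n) ℂ :=
  open Classical in
  fun a => if idx (a + α i) = some i then MvPowerSeries.coeff (a + α i) u else 0

/-- The part of `u` with exponents `β` such that `idx β = none`. -/
def remPart (idx : (Fin n →₀ ℕ) → Option ι) (u : MvPowerSeries (Fin n) ℂ) :
    MvPowerSeries (Fin n) ℂ :=
  open Classical in fun b => if idx b = none then MvPowerSeries.coeff b u else 0

variable (α : ι → Fin n →₀ ℕ) (idx : (Fin n →₀ ℕ) → Option ι)

open Classical in
theorem coeff_quotPart (i : ι) (u : MvPowerSeries (Fin n) ℂ) (a : Fin n →₀ ℕ) :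
    MvPowerSeries.coeff a (quotPart α idx i u) =
      if idx (a + α i) = some i then MvPowerSeries.coeff (a + α i) u else 0 := rfl

open Classical in
theorem coeff_remPart (u : MvPowerSeries (Fin n) ℂ) (b : Fin n →₀ ℕ) :
    MvPowerSeries.coeff b (remPart idx u) =
      if idx b = none then MvPowerSeries.coeff b u else 0 := rfl

theorem sum_quotPart_mul_monomial_add_remPart [Fintype ι] (hidx : ∀ b i, idx b = some i → α i ≤ b)
    (u : MvPowerSeries (Fin n) ℂ) :
    ∑ i, quotPart α idx i u * MvPowerSeries.monomial (α i) 1 + remPart idx u = u := by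
  classical
  ext b
  rw [map_add, map_sum, coeff_remPart]
  have h1 : ∀ i, MvPowerSeries.coeff b (quotPart α idx i u * MvPowerSeries.monomial (α i) 1) =
      if idx b = some i then MvPowerSeries.coeff b u else 0 := fun i => by
    rw [MvPowerSeries.coeff_mul_monomial]
    split_ifs with h2 h3 h3
    · rw [coeff_quotPart, tsub_add_cancel_of_le h2, if_pos h3, mul_one]
    · rw [coeff_quotPart, tsub_add_cancel_of_le h2, if_neg h3, zero_mul]
    · exact absurd (hidx b i h3) h2
    · rfl
  simp_rw [h1]
  cases hb : idx b with
  | none => simp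
  | some i => simp

/-- The parts of `u` have disjoint supports, so no factor counting the divisors appears; the
contraction constant of the division step depends only on `ε`. -/
theorem sum_wnorm_quotPart_le [Fintype ι] (s : ℕ) (u : MvPowerSeries (Fin n) ℂ) :
    ∑ i, wnorm s (quotPart α idx i u) * wt s (α i) ≤ wnorm s u := by
  classical
  have h1 : ∀ i, wnorm s (quotPart α idx i u) * wt s (α i) ≤
      ∑' b, if idx b = some i then ‖MvPowerSeries.coeff b u‖ₑ * wt s b else 0 := fun i => by
    rw [wnorm, ← ENNReal.tsum_mul_right]
    refine le_trans (le_of_eq ?_) (ENNReal.tsum_comp_le_tsum_of_injective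
      (add_left_injective (α i)) _)
    refine tsum_congr fun a => ?_
    rw [coeff_quotPart, wt_add]
    split_ifs
    · ring
    · simp
  refine (Finset.sum_le_sum fun i _ => h1 i).trans ?_
  rw [← Summable.tsum_finsetSum fun _ _ => ENNReal.summable]
  refine ENNReal.tsum_le_tsum fun b => ?_
  cases hb : idx b with
  | none => simp
  | some i => simp

theorem wnorm_remPart_le (s : ℕ) (u : MvPowerSeries (Fin n) ℂ) :
    wnorm s (remPart idx u) ≤ wnorm s u := by
  classical
  refine ENNReal.tsum_le_tsum fun b => ?_
  rw [coeff_remPart]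
  split_ifs <;> simp

/-- The error term of one step of the division algorithm. -/
def divError [Fintype ι] (e : ι → MvPowerSeries (Fin n) ℂ) (u : MvPowerSeries (Fin n) ℂ) :
    MvPowerSeries (Fin n) ℂ :=
  -∑ i, quotPart α idx i u * e i

variable {α idx}

theorem wnorm_divError_le [Fintype ι] {e : ι → MvPowerSeries (Fin n) ℂ} {s : ℕ} {ε : ℝ≥0∞}
    (he : ∀ i, wnorm s (e i) ≤ ε * wt s (α i)) (u : MvPowerSeries (Fin n) ℂ) :
    wnorm s (divError α idx e u) ≤ ε * wnorm s u := by
  rw [divError, wnorm_neg]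
  refine (wnorm_sum_le s _ _).trans ?_
  calc ∑ i, wnorm s (quotPart α idx i u * e i)
      ≤ ∑ i, ε * (wnorm s (quotPart α idx i u) * wt s (α i)) := by
        refine Finset.sum_le_sum fun i _ => (wnorm_mul_le s _ _).trans ?_
        calc _ ≤ wnorm s (quotPart α idx i u) * (ε * wt s (α i)) := by gcongr; exact he i
          _ = _ := by ring
    _ ≤ ε * wnorm s u := by
        rw [← Finset.mul_sum]
        gcongr
        exact sum_wnorm_quotPart_le α idx s u

section

open scoped MvPowerSeries.WithPiTopology

/-- The error operator is continuous for coefficientwise convergence, which is all that summing the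
iteration requires. -/
theorem hasSum_divError [Fintype ι] {e : ι → MvPowerSeries (Fin n) ℂ} {v : ℕ → MvPowerSeries (Fin n) ℂ}
    {u : MvPowerSeries (Fin n) ℂ} (h : HasSum v u) :
    HasSum (fun k => divError α idx e (v k)) (divError α idx e u) := by
  classical
  refine HasSum.neg (hasSum_sum fun i _ => HasSum.mul_right _ ?_)
  rw [MvPowerSeries.WithPiTopology.hasSum_iff_hasSum_coeff] at h ⊢
  intro a
  simp_rw [coeff_quotPart]
  split_ifs
  · exact h _
  · exact hasSum_zero

/-- Convergence of the iterated division algorithm. -/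
theorem exists_eq_add_divError [Fintype ι] {e : ι → MvPowerSeries (Fin n) ℂ} {s : ℕ}
    (he : ∀ i, wnorm s (e i) ≤ 2⁻¹ * wt s (α i)) {g : MvPowerSeries (Fin n) ℂ}
    (hg : wnorm s g ≠ ⊤) :
    ∃ u, wnorm s u ≠ ⊤ ∧ u = g + divError α idx e u := by
  -- The solution is the Neumann series `∑ Tᵏ g` of the error operator `T`, which halves the norm.
  let v : ℕ → MvPowerSeries (Fin n) ℂ := fun k => (divError α idx e)^[k] g
  have hv : ∀ k, wnorm s (v k) ≤ (2⁻¹) ^ k * wnorm s g := by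
    intro k
    induction k with
    | zero => simp [v]
    | succ k ih =>
      simp only [v, Function.iterate_succ_apply']
      refine (wnorm_divError_le he _).trans ?_
      rw [pow_succ', mul_assoc]
      gcongr
  have hgeom : ∑' k : ℕ, ((2 : ℝ≥0∞)⁻¹) ^ k * wnorm s g ≠ ⊤ := by
    rw [ENNReal.tsum_mul_right, ENNReal.tsum_geometric]
    refine ENNReal.mul_ne_top ?_ hg
    simp
  have hsum : ∀ γ, Summable fun k => MvPowerSeries.coeff γ (v k) := fun γ => by
    refine Summable.of_enorm ?_
    have : ∑' k, ‖MvPowerSeries.coeff γ (v k)‖ₑ * wt s γ ≠ ⊤ :=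
      ne_top_of_le_ne_top hgeom (ENNReal.tsum_le_tsum fun k =>
        (enorm_coeff_mul_wt_le s (v k) γ).trans (hv k))
    rw [ENNReal.tsum_mul_right] at this
    intro h
    rw [h, ENNReal.top_mul (wt_ne_zero s γ)] at this
    exact this rfl
  let u : MvPowerSeries (Fin n) ℂ := fun γ => ∑' k, MvPowerSeries.coeff γ (v k)
  have hu : HasSum v u := by
    rw [MvPowerSeries.WithPiTopology.hasSum_iff_hasSum_coeff]
    exact fun γ => (hsum γ).hasSum
  refine ⟨u, ne_top_of_le_ne_top hgeom ?_, ?_⟩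
  · calc wnorm s u ≤ ∑' γ, ∑' k, ‖MvPowerSeries.coeff γ (v k)‖ₑ * wt s γ := by
          refine ENNReal.tsum_le_tsum fun γ => ?_
          rw [ENNReal.tsum_mul_right]
          gcongr
          exact enorm_tsum_le_tsum_enorm
      _ = ∑' k, wnorm s (v k) := ENNReal.tsum_comm
      _ ≤ _ := ENNReal.tsum_le_tsum hv
  · have h1 : HasSum (fun k => v (k + 1)) (divError α idx e u) := by
      simpa only [v, Function.iterate_succ_apply'] using hasSum_divError (α := α) (idx := idx)
        (e := e) hu
    have h2 := (hasSum_nat_add_iff' 1).mpr hu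
    rw [h1.unique h2]
    simp [v]

end

/-- **Division theorem** for convergent power series: every `g` can be divided by finitely many
`f i` with leading exponents `α i`. -/
theorem exists_division [Fintype ι] {f : ι → MvPowerSeries (Fin n) ℂ} {α : ι → Fin n →₀ ℕ}
    (hf : ∀ i, IsConvergent (f i)) (hlead : ∀ i, MvPowerSeries.coeff (α i) (f i) = 1)
    (hα : ∀ i β, MvPowerSeries.coeff β (f i) ≠ 0 → primeWeight (α i) ≤ primeWeight β)
    {g : MvPowerSeries (Fin n) ℂ} (hg : IsConvergent g) :
    ∃ (q : ι → MvPowerSeries (Fin n) ℂ) (r : MvPowerSeries (Fin n) ℂ),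
      (∀ i, IsConvergent (q i)) ∧ IsConvergent r ∧ g = ∑ i, q i * f i + r ∧
      ∀ β i, α i ≤ β → MvPowerSeries.coeff β r = 0 := by
  classical
  -- An exponent divisible by several leading monomials is assigned to an arbitrary one of them.
  let idx : (Fin n →₀ ℕ) → Option ι := fun b => if h : ∃ i, α i ≤ b then some h.choose else none
  have hidx : ∀ b i, idx b = some i → α i ≤ b := by
    intro b i hb
    by_cases h : ∃ i, α i ≤ b
    · simp only [idx, dif_pos h, Option.some.injEq] at hb
      exact hb ▸ h.choose_spec
    · simp [idx, dif_neg h] at hb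
  have hidx' : ∀ b i, α i ≤ b → idx b ≠ none := by
    intro b i hb
    have h : ∃ i, α i ≤ b := ⟨i, hb⟩
    simp [idx, dif_pos h]
  let e : ι → MvPowerSeries (Fin n) ℂ := fun i => f i - MvPowerSeries.monomial (α i) 1
  have hmon : ∀ i, IsConvergent (MvPowerSeries.monomial (α i) (1 : ℂ)) := fun i =>
    ⟨1, one_pos, summable_of_ne_finset_zero (s := {α i}) fun β hβ => by
      have : β ≠ α i := by simpa using hβ
      simp [MvPowerSeries.coeff_monomial, this]⟩
  have he : ∀ i, IsConvergent (e i) := fun i =>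
    (convergentSeries n).sub_mem (hf i) (hmon i)
  have he' : ∀ i β, MvPowerSeries.coeff β (e i) ≠ 0 → primeWeight (α i) < primeWeight β := by
    intro i β hβ
    have hne : β ≠ α i := by
      rintro rfl
      simp [e, hlead] at hβ
    refine lt_of_le_of_ne (hα i β ?_) fun h => hne (primeWeight_injective h.symm)
    simpa [e, MvPowerSeries.coeff_monomial, hne] using hβ
  -- A single `s` makes the norm of `g` finite and all the finitely many tails small.
  obtain ⟨s₁, hs₁⟩ := (isConvergent_iff_wnorm_ne_top g).mp hg
  obtain ⟨s, hs, hes⟩ := ((eventually_ge_atTop s₁).and (eventually_all.mpr fun i =>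
    eventually_wnorm_le (he i) (he' i) (ε := 2⁻¹) (by simp))).exists
  obtain ⟨u, hu, hu'⟩ := exists_eq_add_divError (idx := idx) hes
    (ne_top_of_le_ne_top hs₁ (wnorm_antitone g hs))
  refine ⟨fun i => quotPart α idx i u, remPart idx u, fun i => ?_, ?_, ?_, fun β i hβ => ?_⟩
  · refine (isConvergent_iff_wnorm_ne_top _).mpr ⟨s, fun h => ?_⟩
    have h1 := (Finset.single_le_sum
      (f := fun i => wnorm s (quotPart α idx i u) * wt s (α i)) (fun _ _ => zero_le)
      (Finset.mem_univ i)).trans (sum_wnorm_quotPart_le α idx s u)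
    simp only [h, ENNReal.top_mul (wt_ne_zero s (α i)), top_le_iff] at h1
    exact hu h1
  · exact (isConvergent_iff_wnorm_ne_top _).mpr
      ⟨s, ne_top_of_le_ne_top hu (wnorm_remPart_le idx s u)⟩
  -- Since `u = g - ∑ qᵢ eᵢ` and `u = ∑ qᵢ x ^ αᵢ + r`, adding the tails back gives `g = ∑ qᵢ fᵢ +
  -- r`.
  · have h1 := sum_quotPart_mul_monomial_add_remPart α idx hidx u
    rw [divError, ← sub_eq_add_neg] at hu'
    have h2 : g = u + ∑ i, quotPart α idx i u * e i := by
      linear_combination -hu'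
    rw [h2]
    nth_rewrite 1 [← h1]
    rw [add_right_comm, ← Finset.sum_add_distrib]
    simp [e, mul_sub]
  · rw [coeff_remPart, if_neg (hidx' β i hβ)]

end Division

/-! ### Ring-theoretic properties of `𝓞_S` -/

variable {n : ℕ}

theorem toSeries_injective : Function.Injective (toSeries n) := Subtype.val_injective

theorem isConvergent_toSeries (f : OS n) : IsConvergent (toSeries n f) := f.2

theorem exists_toSeries_eq {f : MvPowerSeries (Fin n) ℂ} (hf : IsConvergent f) :
    ∃ g : OS n, toSeries n g = f := ⟨⟨f, hf⟩, rfl⟩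

/-- `α` is the leading exponent of `f`, and the leading coefficient is `1`. -/
def IsLeading (f : OS n) (α : Fin n →₀ ℕ) : Prop :=
  MvPowerSeries.coeff α (toSeries n f) = 1 ∧
    ∀ β, MvPowerSeries.coeff β (toSeries n f) ≠ 0 → primeWeight α ≤ primeWeight β

theorem exists_isLeading_smul {f : OS n} (hf : f ≠ 0) :
    ∃ (c : ℂ) (α : Fin n →₀ ℕ), MvPowerSeries.coeff α (toSeries n f) ≠ 0 ∧
      IsLeading (algebraMap ℂ (OS n) c * f) α := by
  have h1 : ∃ α, MvPowerSeries.coeff α (toSeries n f) ≠ 0 := by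
    by_contra! h
    exact hf (toSeries_injective (by rw [map_zero]; exact MvPowerSeries.ext (by simpa using h)))
  obtain ⟨α, hα, hmin⟩ := exists_minimalFor_of_wellFoundedLT
    (fun α => MvPowerSeries.coeff α (toSeries n f) ≠ 0) primeWeight h1
  refine ⟨(MvPowerSeries.coeff α (toSeries n f))⁻¹, α, hα, ?_, fun β hβ => ?_⟩
  · rw [← Algebra.smul_def, map_smul, MvPowerSeries.coeff_smul, inv_mul_cancel₀ hα]
  · rw [← Algebra.smul_def, map_smul, MvPowerSeries.coeff_smul] at hβ
    by_contra! hlt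
    exact absurd (hmin (right_ne_zero_of_mul hβ) hlt.le) (not_le.mpr hlt)

theorem exists_division_OS {ι : Type} [Fintype ι] {f : ι → OS n} {α : ι → Fin n →₀ ℕ}
    (hf : ∀ i, IsLeading (f i) (α i)) (g : OS n) :
    ∃ (q : ι → OS n) (r : OS n), g = ∑ i, q i * f i + r ∧
      ∀ β i, α i ≤ β → MvPowerSeries.coeff β (toSeries n r) = 0 := by
  obtain ⟨q, r, hq, hr, e, h⟩ := exists_division (fun i => isConvergent_toSeries (f i))
    (fun i => (hf i).1) (fun i => (hf i).2) (isConvergent_toSeries g)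
  choose q' hq' using fun i => exists_toSeries_eq (hq i)
  obtain ⟨r', rfl⟩ := exists_toSeries_eq hr
  refine ⟨q', r', toSeries_injective ?_, h⟩
  rw [e, map_add, map_sum]
  simp [hq']

/-- **Rückert's basis theorem**. -/
instance isNoetherianRing_OS (n : ℕ) : IsNoetherianRing (OS n) := by
  classical
  rw [isNoetherianRing_iff_ideal_fg]
  intro I
  let S : Set (Fin n →₀ ℕ) := {α | ∃ f ∈ I, IsLeading f α}
  -- Dickson's lemma: minimal exponents form an antichain in a well-quasi-order.
  have hfin : {α | Minimal (· ∈ S) α}.Finite :=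
    WellQuasiOrderedLE.finite_of_isAntichain (setOfPred_minimal_antichain _)
  let ι : Type := {α | Minimal (· ∈ S) α}
  have : Fintype ι := hfin.fintype
  choose f hfI hf using fun i : ι => i.2.1
  refine ⟨Finset.univ.image f, le_antisymm ?_ fun g hg => ?_⟩
  · rw [Ideal.span_le]
    intro x hx
    obtain ⟨i, _, rfl⟩ := Finset.mem_image.mp hx
    exact hfI i
  · obtain ⟨q, r, e, hr⟩ := exists_division_OS hf g
    have hsum : ∑ i, q i * f i ∈ I := sum_mem fun i _ => I.mul_mem_left _ (hfI i)
    have hrI : r ∈ I := by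
      have : r = g - ∑ i, q i * f i := by rw [e]; ring
      rw [this]
      exact sub_mem hg hsum
    -- A nonzero remainder in `I` would have its leading exponent above a minimal one, where its
    -- coefficients vanish.
    have hr0 : r = 0 := by
      by_contra hne
      obtain ⟨c, β, hβ, hlead⟩ := exists_isLeading_smul hne
      have hβS : β ∈ S := ⟨_, I.mul_mem_left _ hrI, hlead⟩
      obtain ⟨α, hle, hmin⟩ := exists_minimal_le_of_wellFoundedLT (· ∈ S) β hβS
      exact hβ (hr β ⟨α, hmin⟩ hle)
    rw [e, hr0, add_zero]
    refine sum_mem fun i _ => Ideal.mul_mem_left _ _ (Ideal.subset_span ?_)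
    simp

/-- With leading exponent `0`, dividing `1` by `f` leaves no room for a remainder. -/
theorem isUnit_of_constantCoeff_ne_zero {f : OS n}
    (hf : MvPowerSeries.constantCoeff (toSeries n f) ≠ 0) : IsUnit f := by
  have h1 : IsLeading (algebraMap ℂ (OS n) (MvPowerSeries.constantCoeff (toSeries n f))⁻¹ * f)
      0 := by
    refine ⟨?_, fun β _ => ?_⟩
    · rw [← Algebra.smul_def, map_smul, MvPowerSeries.coeff_smul,
        MvPowerSeries.coeff_zero_eq_constantCoeff_apply, inv_mul_cancel₀ hf]
    · rw [primeWeight_zero]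
      exact primeWeight_pos β
  obtain ⟨q, r, e, hr⟩ := exists_division_OS (ι := Unit) (fun _ => h1) 1
  have hr0 : r = 0 := toSeries_injective (by
    rw [map_zero]
    exact MvPowerSeries.ext fun β => by simpa using hr β () zero_le)
  rw [hr0, add_zero, Fintype.sum_unique, ← mul_assoc] at e
  exact IsUnit.of_mul_eq_one_right _ e.symm

/-! ### Derivations of `𝓞_S` -/

section Derivations

variable {n : ℕ}

/-- The coordinate functions. -/
def coord (i : Fin n) : OS n :=
  ⟨MvPowerSeries.X i, 1, one_pos, summable_of_ne_finset_zero (s := {Finsupp.single i 1})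
    fun β hβ => by
      classical
      have : β ≠ Finsupp.single i 1 := by simpa using hβ
      simp [MvPowerSeries.coeff_X, this]⟩

theorem toSeries_coord (i : Fin n) : toSeries n (coord i) = MvPowerSeries.X i := rfl

theorem toSeries_partialD (i : Fin n) (f : OS n) :
    toSeries n (partialD i f) = MvPowerSeries.pderiv ℂ i (toSeries n f) := rfl

theorem partialD_coord_same (i : Fin n) : partialD i (coord i) = 1 :=
  toSeries_injective (by
    rw [toSeries_partialD, toSeries_coord, map_one]
    simp)

theorem partialD_coord_of_ne {i j : Fin n} (h : i ≠ j) : partialD i (coord j) = 0 :=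
  toSeries_injective (by
    rw [toSeries_partialD, toSeries_coord, map_zero]
    simp [h.symm])

theorem isLeading_coord (i : Fin n) : IsLeading (coord i) (Finsupp.single i 1) := by
  classical
  refine ⟨?_, fun β hβ => ?_⟩
  · rw [toSeries_coord, MvPowerSeries.coeff_X, if_pos rfl]
  · rw [toSeries_coord, MvPowerSeries.coeff_X] at hβ
    rw [(ite_ne_right_iff.mp hβ).1]

theorem exists_eq_sum_mul_coord_add (f : OS n) :
    ∃ (q : Fin n → OS n) (c : ℂ), f = ∑ i, q i * coord i + algebraMap ℂ (OS n) c := by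
  classical
  obtain ⟨q, r, e, hr⟩ := exists_division_OS isLeading_coord f
  refine ⟨q, MvPowerSeries.constantCoeff (toSeries n r), ?_⟩
  rw [e]
  congr 1
  refine toSeries_injective (MvPowerSeries.ext fun β => ?_)
  rw [AlgHom.commutes, MvPowerSeries.algebraMap_apply, MvPowerSeries.coeff_C]
  split_ifs with h
  · subst h
    simp
  · obtain ⟨i, hi⟩ := Finsupp.ne_iff.mp h
    refine hr β i ?_
    rw [Finsupp.single_le_iff]
    exact Nat.one_le_iff_ne_zero.mpr hi

/-- No continuity is assumed. From `f = ∑ qᵢ xᵢ + c` follows `δ f = ∑ xᵢ δ qᵢ`, so each coefficient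
of `δ f` reduces to coefficients of lower degree of the `δ qᵢ`. -/
theorem derivation_eq_zero_of_coord {δ : Theta n} (h : ∀ i, δ (coord i) = 0) : δ = 0 := by
  classical
  have key : ∀ (d : ℕ) (β : Fin n →₀ ℕ), β.degree ≤ d → ∀ f : OS n,
      MvPowerSeries.coeff β (toSeries n (δ f)) = 0 := by
    have step : ∀ (β : Fin n →₀ ℕ),
        (∀ γ : Fin n →₀ ℕ, γ.degree < β.degree → ∀ f : OS n,
          MvPowerSeries.coeff γ (toSeries n (δ f)) = 0) →
        ∀ f : OS n, MvPowerSeries.coeff β (toSeries n (δ f)) = 0 := by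
      intro β ih f
      obtain ⟨q, c, rfl⟩ := exists_eq_sum_mul_coord_add f
      rw [map_add, Derivation.map_algebraMap, add_zero, map_sum, map_sum, map_sum]
      refine Finset.sum_eq_zero fun i _ => ?_
      rw [Derivation.leibniz, h, smul_zero, zero_add, smul_eq_mul, map_mul, toSeries_coord,
        MvPowerSeries.X, MvPowerSeries.coeff_monomial_mul]
      split_ifs with hi
      · rw [ih, mul_zero]
        have : β.degree = (β - Finsupp.single i 1).degree + 1 := by
          conv_lhs => rw [← tsub_add_cancel_of_le hi, map_add, Finsupp.degree_single]
        omega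
      · rfl
    intro d
    induction d with
    | zero => exact fun β hβ => step β fun γ hγ => by omega
    | succ d ih => exact fun β hβ => step β fun γ hγ => ih γ (by omega)
  exact Derivation.ext fun f => toSeries_injective (MvPowerSeries.ext fun β => by
    simpa using key _ β le_rfl f)

theorem derivation_eq_sum (δ : Theta n) : δ = ∑ i, δ (coord i) • partialD i := by
  rw [← sub_eq_zero]
  refine derivation_eq_zero_of_coord fun j => ?_
  rw [Derivation.sub_apply, ← Derivation.coeFnAddMonoidHom_apply (∑ i, _), map_sum,
    Finset.sum_apply, Finset.sum_eq_single j]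
  · simp [partialD_coord_same]
  · intro i _ hi
    simp [partialD_coord_of_ne hi]
  · simp

theorem derivation_apply_eq_sum (δ : Theta n) (f : OS n) :
    δ f = ∑ i, δ (coord i) * partialD i f := by
  conv_lhs => rw [derivation_eq_sum δ]
  rw [← Derivation.coeFnAddMonoidHom_apply (∑ i, _), map_sum, Finset.sum_apply]
  rfl

/-- The vector field `∑ cᵢ ∂ᵢ`. -/
def vectorField (c : Fin n → OS n) : Theta n := ∑ i, c i • partialD i

theorem vectorField_apply (c : Fin n → OS n) (f : OS n) :
    vectorField c f = ∑ i, c i * partialD i f := by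
  rw [vectorField, ← Derivation.coeFnAddMonoidHom_apply (∑ i, _), map_sum, Finset.sum_apply]
  rfl

/-- In characteristic zero, differentiating along a nonzero coefficient of `f` lowers its degree
without killing it, until the constant term is nonzero and the ideal contains a unit. -/
theorem eq_top_of_partialD_mem {I : Ideal (OS n)} (hI : ∀ i, ∀ f ∈ I, partialD i f ∈ I)
    (hne : I ≠ ⊥) : I = ⊤ := by
  classical
  obtain ⟨f, hf, hf0⟩ := Submodule.exists_mem_ne_zero_of_ne_bot hne
  obtain ⟨β, hβ⟩ : ∃ β, MvPowerSeries.coeff β (toSeries n f) ≠ 0 := by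
    by_contra! h
    exact hf0 (toSeries_injective (by rw [map_zero]; exact MvPowerSeries.ext (by simpa using h)))
  have key : ∀ (d : ℕ) (β : Fin n →₀ ℕ), β.degree = d → ∀ f ∈ I,
      MvPowerSeries.coeff β (toSeries n f) ≠ 0 → I = ⊤ := by
    intro d
    induction d with
    | zero =>
      intro β hβ f hf h
      rw [Finsupp.degree_eq_zero_iff] at hβ
      subst hβ
      exact Ideal.eq_top_of_isUnit_mem I hf (isUnit_of_constantCoeff_ne_zero (by simpa using h))
    | succ d ih =>
      intro β hβ f hf h
      obtain ⟨i, hi⟩ : ∃ i, β i ≠ 0 := by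
        by_contra! h0
        rw [show β = 0 from Finsupp.ext h0] at hβ
        simp at hβ
      have hle : Finsupp.single i 1 ≤ β := by
        rw [Finsupp.single_le_iff]
        exact Nat.one_le_iff_ne_zero.mpr hi
      have hβ' : β - Finsupp.single i 1 + Finsupp.single i 1 = β := tsub_add_cancel_of_le hle
      refine ih (β - Finsupp.single i 1) ?_ (partialD i f) (hI i f hf) ?_
      · rw [← hβ', map_add, Finsupp.degree_single] at hβ
        omega
      · rw [toSeries_partialD, MvPowerSeries.coeff_pderiv, hβ']
        exact mul_ne_zero h (Nat.cast_add_one_ne_zero _)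
  exact key _ β rfl f hf hβ

end Derivations

/-! ### The Jacobian ideal contains a non-zero-divisor -/

section Jacobian

variable {n : ℕ} {h : OS n}

/-- The maximal ideal of the localization at `p` is its nilradical, so `t xᵏ = 0` for some `t ∉ p`;
then `x t` is nilpotent, hence zero. -/
theorem exists_mul_eq_zero_of_mem_minimalPrimes {A : Type} [CommRing A] [IsReduced A]
    {p : Ideal A} (hp : p ∈ minimalPrimes A) {x : A} (hx : x ∈ p) : ∃ y ∉ p, x * y = 0 := by
  have hprime : p.IsPrime := hp.1.1
  have hrad := IsLocalization.AtPrime.radical_map_of_mem_minimalPrimes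
    (A := Localization.AtPrime p) p ⊥ hp
  have hx' : algebraMap A (Localization.AtPrime p) x ∈
      ((⊥ : Ideal A).map (algebraMap A (Localization.AtPrime p))).radical := by
    rw [hrad]
    exact Ideal.mem_map_of_mem _ hx
  obtain ⟨k, hk⟩ := hx'
  rw [Ideal.map_bot, Ideal.mem_bot, ← map_pow,
    IsLocalization.map_eq_zero_iff p.primeCompl] at hk
  obtain ⟨t, ht⟩ := hk
  refine ⟨t, t.2, eq_zero_of_pow_eq_zero (n := k + 1) ?_⟩
  rw [mul_pow, pow_succ x, pow_succ' (t : A)]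
  linear_combination x * (t : A) ^ k * ht

theorem not_jacobianIdeal_le_of_mem_minimalPrimes (h_ne : h ≠ 0) (h_red : IsReduced (OD h))
    {p : Ideal (OD h)} (hp : p ∈ minimalPrimes (OD h)) : ¬ jacobianIdeal h ≤ p := by
  intro hJ
  have hprime : p.IsPrime := hp.1.1
  have hJ' : ∀ i, partialD i h ∈ p.comap (restr h) := fun i =>
    hJ (Ideal.subset_span ⟨i, rfl⟩)
  have hhp : h ∈ p.comap (restr h) := by
    rw [Ideal.mem_comap, Ideal.Quotient.eq_zero_iff_mem.mpr (Ideal.mem_span_singleton_self h)]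
    exact zero_mem p
  have htop : p.comap (restr h) = ⊤ := by
    refine eq_top_of_partialD_mem (fun i f hf => ?_) fun hbot => ?_
    -- Differentiating `f s = a h` with `s` outside the prime puts `s · ∂ᵢf` in it, hence also
    -- `∂ᵢf`.
    · obtain ⟨y, hy, hfy⟩ := exists_mul_eq_zero_of_mem_minimalPrimes hp hf
      obtain ⟨s, rfl⟩ := Ideal.Quotient.mk_surjective y
      have hz : restr h (f * s) = 0 := by
        rw [map_mul]
        exact hfy
      obtain ⟨a, ha⟩ := Ideal.mem_span_singleton'.mp (Ideal.Quotient.eq_zero_iff_mem.mp hz)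
      have hd := congrArg (partialD i) ha
      simp only [Derivation.leibniz, smul_eq_mul] at hd
      have hmem : s * partialD i f ∈ p.comap (restr h) := by
        have : s * partialD i f = a * partialD i h + h * partialD i a - f * partialD i s := by
          linear_combination -hd
        rw [this]
        exact sub_mem (add_mem (Ideal.mul_mem_left _ _ (hJ' i)) (Ideal.mul_mem_right _ _ hhp))
          (Ideal.mul_mem_right _ _ hf)
      exact ((hprime.comap (restr h)).mem_or_mem hmem).resolve_left hy
    · rw [hbot] at hhp
      exact h_ne hhp
  exact (hprime.comap (restr h)).ne_top htop

theorem exists_mem_jacobianIdeal_nonZeroDivisors (h_ne : h ≠ 0) (h_red : IsReduced (OD h)) :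
    ∃ j ∈ jacobianIdeal h, j ∈ (OD h)⁰ := by
  classical
  have hfin : (minimalPrimes (OD h)).Finite := minimalPrimes.finite_of_isNoetherianRing (OD h)
  have h1 : ¬ (jacobianIdeal h : Set (OD h)) ⊆ ⋃ p ∈ (hfin.toFinset : Set (Ideal (OD h))), p := by
    -- Prime avoidance allows two non-prime exceptions; none is needed, so `⊥ ⊥` are placeholders.
    rw [Ideal.subset_union_prime (f := fun p : Ideal (OD h) => p) ⊥ ⊥
      (fun p hp _ _ => (hfin.mem_toFinset.mp hp).1.1)]
    rintro ⟨p, hp, hle⟩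
    exact not_jacobianIdeal_le_of_mem_minimalPrimes h_ne h_red (hfin.mem_toFinset.mp hp) hle
  obtain ⟨j, hj, hj'⟩ := Set.not_subset.mp h1
  refine ⟨j, hj, mem_nonZeroDivisors_iff_right.mpr fun y hy => ?_⟩
  -- As `j` avoids every minimal prime, `y j = 0` forces `y` into all of them, that is, into the
  -- nilradical.
  have hy' : y ∈ sInf (minimalPrimes (OD h)) := by
    refine Ideal.mem_sInf.mpr fun {p} hp => ?_
    have hprime : p.IsPrime := hp.1.1
    refine (hprime.mem_or_mem (show y * j ∈ p by rw [hy]; exact zero_mem p)).resolve_right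
      fun hjp => hj' ?_
    exact Set.mem_biUnion (hfin.mem_toFinset.mpr hp) hjp
  rw [minimalPrimes, Ideal.sInf_minimalPrimes] at hy'
  obtain ⟨k, hk⟩ := hy'
  exact eq_zero_of_pow_eq_zero (by simpa using hk)

theorem exists_sum_partialD_nonZeroDivisors (h_ne : h ≠ 0) (h_red : IsReduced (OD h)) :
    ∃ c : Fin n → OS n, restr h (∑ i, c i * partialD i h) ∈ (OD h)⁰ := by
  obtain ⟨j, hj, hj'⟩ := exists_mem_jacobianIdeal_nonZeroDivisors h_ne h_red
  obtain ⟨c, rfl⟩ := (Submodule.mem_span_range_iff_exists_fun _).mp hj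
  choose c' hc' using fun i => Ideal.Quotient.mk_surjective (c i)
  refine ⟨c', ?_⟩
  rw [map_sum]
  simpa only [map_mul, hc', smul_eq_mul] using hj'

end Jacobian

/-! ### Duals of fractional ideals -/

section FracIdeal

variable {A : Type} [CommRing A] {I : Submodule A (FractionRing A)}

theorem isUnit_of_mem_nonZeroDivisors {x : FractionRing A} (hx : x ∈ (FractionRing A)⁰) :
    IsUnit x := by
  obtain ⟨⟨a, s⟩, hs⟩ := IsLocalization.surj A⁰ x
  simp only at hs
  have ha : a ∈ A⁰ := mem_nonZeroDivisors_iff_right.mpr fun b hb => by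
    refine (map_eq_zero_iff _ (algebraMap_injective A)).mp ?_
    refine (mul_right_mem_nonZeroDivisors_eq_zero_iff
      (mul_mem hx (IsLocalization.map_units _ s).mem_nonZeroDivisors)).mp ?_
    rw [hs, ← map_mul, hb, map_zero]
  have h1 := IsLocalization.map_units (FractionRing A) (⟨a, ha⟩ : A⁰)
  rw [← hs] at h1
  exact isUnit_of_mul_isUnit_left h1

/-- Clearing denominators gives `φ(x) y = φ(y) x`, so `φ` is multiplication by `φ(x) / x`. -/
theorem mulHom_bijective {x : FractionRing A} (hxI : x ∈ I) (hx : x ∈ (FractionRing A)⁰) :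
    Function.Bijective (mulHom I) := by
  constructor
  · intro f g hfg
    have h1 := congrArg (algebraMap A (FractionRing A)) (LinearMap.congr_fun hfg ⟨x, hxI⟩)
    rw [algebraMap_mulHom, algebraMap_mulHom] at h1
    exact Subtype.ext ((isUnit_of_mem_nonZeroDivisors hx).mul_right_cancel h1)
  · intro φ
    obtain ⟨u, hu⟩ : IsUnit x := isUnit_of_mem_nonZeroDivisors hx
    have key : ∀ y : I, algebraMap A (FractionRing A) (φ ⟨x, hxI⟩) * y.1 =
        algebraMap A (FractionRing A) (φ y) * x := by
      intro y
      obtain ⟨⟨a, s⟩, hs⟩ := IsLocalization.surj A⁰ x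
      obtain ⟨⟨b, t⟩, ht⟩ := IsLocalization.surj A⁰ y.1
      simp only at hs ht
      have h1 : (b * (s : A)) • (⟨x, hxI⟩ : I) = (a * (t : A)) • y := by
        refine Subtype.ext ?_
        simp only [Submodule.coe_smul, Algebra.smul_def, map_mul]
        rw [← hs, ← ht]
        ring
      have h2 := congrArg (algebraMap A (FractionRing A)) (congrArg φ h1)
      simp only [map_smul, smul_eq_mul, map_mul] at h2
      rw [← hs, ← ht] at h2
      have hst : IsUnit (algebraMap A (FractionRing A) s * algebraMap A (FractionRing A) t) :=
        (IsLocalization.map_units _ s).mul (IsLocalization.map_units _ t)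
      refine hst.mul_left_cancel ?_
      linear_combination h2
    have hmem : algebraMap A (FractionRing A) (φ ⟨x, hxI⟩) * ↑u⁻¹ ∈ fracDual I := by
      refine Submodule.mem_div_iff_forall_mul_mem.mpr fun y hy => Submodule.mem_one.mpr
        ⟨φ ⟨y, hy⟩, ?_⟩
      rw [mul_right_comm, key ⟨y, hy⟩, ← hu, mul_assoc, Units.mul_inv, mul_one]
    refine ⟨⟨_, hmem⟩, LinearMap.ext fun y => algebraMap_injective A ?_⟩
    rw [algebraMap_mulHom, mul_right_comm, key y, ← hu, mul_assoc, Units.mul_inv, mul_one]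

/-- Multiplication by `x` embeds the dual into the Noetherian module `A`. -/
theorem fracDual_fg [IsNoetherianRing A] {x : FractionRing A} (hxI : x ∈ I)
    (hx : x ∈ (FractionRing A)⁰) : (fracDual I).FG := by
  have hinj : Function.Injective ((LinearMap.applyₗ (⟨x, hxI⟩ : I)).comp (mulHom I)) := by
    intro f g hfg
    have h1 := congrArg (algebraMap A (FractionRing A)) hfg
    simp only [LinearMap.comp_apply, LinearMap.applyₗ_apply_apply] at h1
    rw [algebraMap_mulHom, algebraMap_mulHom] at h1
    exact Subtype.ext ((isUnit_of_mem_nonZeroDivisors hx).mul_right_cancel h1)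
  have : IsNoetherian A (fracDual I) := isNoetherian_of_injective _ hinj
  exact isNoetherian_submodule.mp this _ le_rfl

end FracIdeal

/-! ### Logarithmic forms and their residues -/

section Residue

variable {n : ℕ} {h : OS n}

/-- Logarithmic forms in terms of their numerators `a = h ω`. -/
theorem mem_logForms_iff (h_ne : h ≠ 0) {ω : MeroForm n} {a : Fin n → OS n}
    (ha : ∀ i, algebraMap (OS n) (MS n) h * ω i = algebraMap (OS n) (MS n) (a i)) :
    ω ∈ logForms h ↔
      ∀ i j, partialD i h * a j - partialD j h * a i ∈ Ideal.span {h} := by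
  have hh : algebraMap (OS n) (MS n) h ≠ 0 := by
    simpa using (algebraMap_injective (OS n)).ne h_ne
  have hd : ∀ i j, algebraMap (OS n) (MS n) h * extendDer (partialD i) (ω j) =
      algebraMap (OS n) (MS n) (partialD i (a j)) -
        algebraMap (OS n) (MS n) (partialD i h) * ω j := by
    intro i j
    have h1 := congrArg (extendDer (partialD i)) (ha j)
    rw [Derivation.leibniz, extendDer_algebraMap, extendDer_algebraMap, smul_eq_mul,
      smul_eq_mul] at h1
    linear_combination h1
  -- This is `h dω = da - dh ∧ ω`; only the term `dh ∧ ω = dh ∧ a / h` can fail to be holomorphic.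
  have hext : ∀ i j, algebraMap (OS n) (MS n) h * extD ω i j =
      algebraMap (OS n) (MS n) (partialD i (a j) - partialD j (a i)) -
        (algebraMap (OS n) (MS n) (partialD i h) * ω j -
          algebraMap (OS n) (MS n) (partialD j h) * ω i) := by
    intro i j
    rw [extD, mul_sub, hd, hd, map_sub]
    ring
  constructor
  · rintro ⟨_, h2⟩ i j
    obtain ⟨b, hb⟩ := h2 i j
    rw [hext] at hb
    refine Ideal.mem_span_singleton'.mpr ⟨partialD i (a j) - partialD j (a i) - b,
      algebraMap_injective (OS n) ?_⟩
    simp only [map_mul, map_sub, ← ha] at hb ⊢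
    linear_combination -algebraMap (OS n) (MS n) h * hb
  · intro h1
    refine ⟨fun i => ⟨a i, (ha i).symm⟩, fun i j => ?_⟩
    obtain ⟨b, hb⟩ := Ideal.mem_span_singleton'.mp (h1 i j)
    refine ⟨partialD i (a j) - partialD j (a i) - b, ?_⟩
    rw [hext]
    have h2 := congrArg (algebraMap (OS n) (MS n)) hb
    refine mul_left_cancel₀ hh ?_
    simp only [map_mul, map_sub, ← ha] at h2 ⊢
    linear_combination -h2

/-- The numerator `h ω` of a logarithmic form. -/
def numerator (h : OS n) : logForms h →ₗ[OS n] (Fin n → OS n) where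
  toFun ω := fun i => (ω.2.1 i).choose
  map_add' ω ω' := funext fun i => algebraMap_injective (OS n) (by
    rw [Pi.add_apply, map_add, ((ω + ω').2.1 i).choose_spec, (ω.2.1 i).choose_spec,
      (ω'.2.1 i).choose_spec]
    simp [mul_add])
  map_smul' f ω := funext fun i => algebraMap_injective (OS n) (by
    rw [RingHom.id_apply, Pi.smul_apply, smul_eq_mul, map_mul, ((f • ω).2.1 i).choose_spec,
      (ω.2.1 i).choose_spec]
    simp only [Submodule.coe_smul, Pi.smul_apply, Algebra.smul_def]
    ring)

theorem algebraMap_numerator (ω : logForms h) (i : Fin n) :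
    algebraMap (OS n) (MS n) (numerator h ω i) = algebraMap (OS n) (MS n) h * ω.1 i :=
  (ω.2.1 i).choose_spec

theorem numerator_injective (h_ne : h ≠ 0) : Function.Injective (numerator h) := by
  intro ω ω' e
  have hh : algebraMap (OS n) (MS n) h ≠ 0 := by
    simpa using (algebraMap_injective (OS n)).ne h_ne
  refine Subtype.ext (funext fun i => mul_left_cancel₀ hh ?_)
  rw [← algebraMap_numerator, e, algebraMap_numerator]

theorem exists_numerator_eq (h_ne : h ≠ 0) {a : Fin n → OS n}
    (ha : ∀ i j, partialD i h * a j - partialD j h * a i ∈ Ideal.span {h}) :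
    ∃ ω : logForms h, numerator h ω = a := by
  have hh : algebraMap (OS n) (MS n) h ≠ 0 := by
    simpa using (algebraMap_injective (OS n)).ne h_ne
  have h1 : ∀ i, algebraMap (OS n) (MS n) h *
      (algebraMap (OS n) (MS n) (a i) / algebraMap (OS n) (MS n) h) =
      algebraMap (OS n) (MS n) (a i) := fun i => mul_div_cancel₀ _ hh
  refine ⟨⟨fun i => algebraMap (OS n) (MS n) (a i) / algebraMap (OS n) (MS n) h,
    (mem_logForms_iff h_ne h1).mpr ha⟩, funext fun i => algebraMap_injective (OS n) ?_⟩
  rw [algebraMap_numerator, h1]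

/-- A holomorphic form is logarithmic. -/
def holForm (h : OS n) : (Fin n → OS n) →ₗ[OS n] logForms h where
  toFun b := ⟨fun i => algebraMap (OS n) (MS n) (b i), fun i => ⟨h * b i, map_mul _ _ _⟩,
    fun i j => ⟨h * (partialD i (b j) - partialD j (b i)), by
      simp [extD, extendDer_algebraMap]⟩⟩
  map_add' b b' := Subtype.ext (funext fun i => map_add _ _ _)
  map_smul' f b := Subtype.ext (funext fun i => by
    simp [Algebra.smul_def])

theorem numerator_holForm (b : Fin n → OS n) : numerator h (holForm h b) = h • b :=
  funext fun i => algebraMap_injective (OS n) (by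
    rw [algebraMap_numerator, Pi.smul_apply, smul_eq_mul, map_mul]
    rfl)

theorem holForm_numerator (ω : logForms h) : holForm h (numerator h ω) = h • ω :=
  Subtype.ext (funext fun i => by
    change algebraMap (OS n) (MS n) (numerator h ω i) = _
    rw [algebraMap_numerator, Submodule.coe_smul, Pi.smul_apply, Algebra.smul_def])

theorem restr_numerator_mul_comm (h_ne : h ≠ 0) (ω : logForms h) (i j : Fin n) :
    restr h (partialD i h) * restr h (numerator h ω j) =
      restr h (partialD j h) * restr h (numerator h ω i) := by
  rw [← map_mul, ← map_mul, Ideal.Quotient.eq]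
  exact (mem_logForms_iff h_ne fun i => (algebraMap_numerator ω i).symm).mp ω.2 i j

/-- The residue `r` of `ω` is characterized by `∂ⱼh · r = h ωⱼ` on `D`. -/
theorem isResidue_iff (ω : logForms h) (r : MD h) :
    IsResidue h ω.1 r ↔ ∀ j, algebraMap (OD h) (MD h) (restr h (partialD j h)) * r =
      algebraMap (OD h) (MD h) (restr h (numerator h ω j)) := by
  constructor
  · rintro ⟨ξ, g, η, hg, e, rfl⟩ j
    have h1 : g * numerator h ω j = ξ * partialD j h + h * η j := by
      refine algebraMap_injective (OS n) ?_
      rw [← e j, map_mul, map_mul, algebraMap_numerator]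
      ring
    have h2 := congrArg (restr h) h1
    rw [map_add, map_mul, map_mul, map_mul,
      Ideal.Quotient.eq_zero_iff_mem.mpr (Ideal.mem_span_singleton_self h), zero_mul,
      add_zero] at h2
    rw [← IsLocalization.mk'_one (M := (OD h)⁰) (MD h), ← IsLocalization.mk'_mul,
      ← IsLocalization.mk'_one (M := (OD h)⁰) (MD h), IsLocalization.mk'_eq_iff_eq]
    congr 1
    simp only [one_mul, OneMemClass.coe_one]
    rw [h2]
    ring
  · intro hr
    obtain ⟨ξ, ⟨g, hg⟩, rfl⟩ := IsLocalization.exists_mk'_eq (OD h)⁰ r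
    obtain ⟨ξ, rfl⟩ := Ideal.Quotient.mk_surjective ξ
    obtain ⟨g, rfl⟩ := Ideal.Quotient.mk_surjective g
    have h1 : ∀ j, ∃ η, η * h = g * numerator h ω j - ξ * partialD j h := by
      intro j
      refine Ideal.mem_span_singleton'.mp (Ideal.Quotient.eq.mp ?_)
      refine algebraMap_injective (OD h) ?_
      rw [map_mul, map_mul, map_mul, map_mul, ← hr j]
      have h2 := IsLocalization.mk'_spec (MD h) (restr h ξ) (⟨restr h g, hg⟩ : (OD h)⁰)
      simp only at h2 ⊢
      rw [← h2]
      ring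
    choose η hη using h1
    refine ⟨ξ, g, η, hg, fun j => ?_, rfl⟩
    have h2 := congrArg (algebraMap (OS n) (MS n)) (hη j)
    simp only [map_mul, map_add, map_sub, algebraMap_numerator] at h2 ⊢
    linear_combination -h2

theorem eq_of_partialD_mul_eq {c : Fin n → OS n}
    (hc : restr h (∑ i, c i * partialD i h) ∈ (OD h)⁰) {r r' : MD h}
    (e : ∀ j, algebraMap (OD h) (MD h) (restr h (partialD j h)) * r =
      algebraMap (OD h) (MD h) (restr h (partialD j h)) * r') : r = r' := by
  refine (IsLocalization.map_units (MD h) (⟨_, hc⟩ : (OD h)⁰)).mul_left_cancel ?_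
  simp only [map_sum, map_mul, Finset.sum_mul]
  refine Finset.sum_congr rfl fun j _ => ?_
  rw [mul_assoc, e j, mul_assoc]

theorem exists_residue (h_ne : h ≠ 0) {c : Fin n → OS n}
    (hc : restr h (∑ i, c i * partialD i h) ∈ (OD h)⁰) (ω : logForms h) :
    ∃ r, IsResidue h ω.1 r := by
  refine ⟨IsLocalization.mk' (MD h) (restr h (∑ i, c i * numerator h ω i))
    (⟨_, hc⟩ : (OD h)⁰), (isResidue_iff ω _).mpr fun j => ?_⟩
  rw [← IsLocalization.mk'_one (M := (OD h)⁰) (MD h), ← IsLocalization.mk'_mul,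
      ← IsLocalization.mk'_one (M := (OD h)⁰) (MD h), IsLocalization.mk'_eq_iff_eq]
  congr 1
  simp only [one_mul, OneMemClass.coe_one, map_sum, map_mul, Finset.mul_sum, Finset.sum_mul]
  refine Finset.sum_congr rfl fun i _ => ?_
  linear_combination -restr h (c i) * restr_numerator_mul_comm h_ne ω i j

theorem exists_residueMap (h_ne : h ≠ 0) (h_red : IsReduced (OD h)) :
    ∃ ρ : logForms h →ₗ[OS n] residueModule h,
      ∀ (ω : logForms h) (r : MD h), IsResidue h ω.1 r ↔ r = (ρ ω).1 := by
  obtain ⟨c, hc⟩ := exists_sum_partialD_nonZeroDivisors h_ne h_red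
  choose ρ hρ using exists_residue h_ne hc
  have huniq : ∀ (ω : logForms h) (r : MD h), IsResidue h ω.1 r ↔ r = ρ ω := by
    refine fun ω r => ⟨fun hr => ?_, fun hr => hr ▸ hρ ω⟩
    rw [isResidue_iff] at hr
    have h1 := (isResidue_iff ω _).mp (hρ ω)
    exact eq_of_partialD_mul_eq hc fun j => (hr j).trans (h1 j).symm
  have hspec := fun ω => (isResidue_iff ω _).mp (hρ ω)
  refine ⟨{ toFun := fun ω => ⟨ρ ω, ω.1, ω.2, hρ ω⟩
            map_add' := fun ω ω' => Subtype.ext ?_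
            map_smul' := fun f ω => Subtype.ext ?_ }, huniq⟩
  · refine ((huniq _ _).mp ((isResidue_iff _ _).mpr fun j => ?_)).symm
    simp only [Submodule.coe_add]
    rw [mul_add, hspec, hspec, map_add, Pi.add_apply, map_add, map_add]
  · refine ((huniq _ _).mp ((isResidue_iff _ _).mpr fun j => ?_)).symm
    rw [RingHom.id_apply, map_smul, Pi.smul_apply, smul_eq_mul, map_mul, map_mul, ← hspec]
    have : ((f • (⟨ρ ω, ω.1, ω.2, hρ ω⟩ : residueModule h) : residueModule h) : MD h) =
        algebraMap (OD h) (MD h) (restr h f) * ρ ω := by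
      change f • ρ ω = _
      rw [← Algebra.smul_def]
      exact (algebraMap_smul (OD h) f (ρ ω)).symm
    rw [this]
    ring

theorem fracDual_jacobianFrac (h_ne : h ≠ 0) : fracDual (jacobianFrac h) = residueModule h := by
  ext f
  constructor
  · intro hf
    have h1 : ∀ j, ∃ a : OS n, algebraMap (OD h) (MD h) (restr h (partialD j h)) * f =
        algebraMap (OD h) (MD h) (restr h a) := by
      intro j
      have hj : algebraMap (OD h) (MD h) (restr h (partialD j h)) ∈ jacobianFrac h :=
        ⟨_, Ideal.subset_span ⟨j, rfl⟩, rfl⟩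
      obtain ⟨y, hy⟩ := fracDual_mul ⟨f, hf⟩ ⟨_, hj⟩
      obtain ⟨a, rfl⟩ := Ideal.Quotient.mk_surjective y
      exact ⟨a, by rw [hy, mul_comm]⟩
    choose a ha using h1
    obtain ⟨ω, rfl⟩ : ∃ ω : logForms h, numerator h ω = a := by
      refine exists_numerator_eq h_ne fun i j => Ideal.Quotient.eq.mp ?_
      refine algebraMap_injective (OD h) ?_
      rw [map_mul, map_mul, map_mul, map_mul, ← ha, ← ha]
      ring
    exact ⟨ω.1, ω.2, (isResidue_iff ω f).mpr ha⟩
  · rintro ⟨ω, hω, hr⟩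
    have h1 := (isResidue_iff ⟨ω, hω⟩ f).mp hr
    refine Submodule.mem_div_iff_forall_mul_mem.mpr ?_
    rintro _ ⟨y, hy, rfl⟩
    change f * algebraMap (OD h) (MD h) y ∈ _
    obtain ⟨c, rfl⟩ := (Submodule.mem_span_range_iff_exists_fun _).mp hy
    rw [map_sum, Finset.mul_sum]
    refine sum_mem fun i _ => Submodule.mem_one.mpr
      ⟨c i * restr h (numerator h ⟨ω, hω⟩ i), ?_⟩
    rw [map_mul, ← h1, smul_eq_mul, map_mul]
    ring

/-- The form `dh / h` has residue `1`. -/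
theorem one_mem_residueModule (h_ne : h ≠ 0) : (1 : MD h) ∈ residueModule h := by
  obtain ⟨ω, hω⟩ := exists_numerator_eq h_ne (a := fun i => partialD i h) fun i j => by
    rw [mul_comm, sub_self]
    exact zero_mem _
  exact ⟨ω.1, ω.2, (isResidue_iff ω 1).mpr fun j => by rw [hω, mul_one]⟩

theorem exists_mem_jacobianFrac_nonZeroDivisors (h_ne : h ≠ 0) (h_red : IsReduced (OD h)) :
    ∃ x ∈ jacobianFrac h, x ∈ (MD h)⁰ := by
  obtain ⟨j, hj, hj'⟩ := exists_mem_jacobianIdeal_nonZeroDivisors h_ne h_red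
  exact ⟨algebraMap (OD h) (MD h) j, ⟨j, hj, rfl⟩,
    (IsLocalization.map_units (MD h) (⟨j, hj'⟩ : (OD h)⁰)).mem_nonZeroDivisors⟩

theorem isFracIdeal_jacobianFrac (h_ne : h ≠ 0) (h_red : IsReduced (OD h)) :
    IsFracIdeal (jacobianFrac h) :=
  ⟨Submodule.FG.map _ (IsNoetherian.noetherian (jacobianIdeal h)),
    exists_mem_jacobianFrac_nonZeroDivisors h_ne h_red⟩

theorem isFracIdeal_residueModule (h_ne : h ≠ 0) (h_red : IsReduced (OD h)) :
    IsFracIdeal (residueModule h) := by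
  obtain ⟨x, hx, hx'⟩ := exists_mem_jacobianFrac_nonZeroDivisors h_ne h_red
  refine ⟨?_, 1, one_mem_residueModule h_ne, one_mem _⟩
  rw [← fracDual_jacobianFrac h_ne]
  exact fracDual_fg hx hx'

theorem algebraMap_mem_fracDual_residueModule (h_ne : h ≠ 0) {y : OD h}
    (hy : y ∈ jacobianIdeal h) : algebraMap (OD h) (MD h) y ∈ fracDual (residueModule h) := by
  refine Submodule.mem_div_iff_forall_mul_mem.mpr fun r hr => ?_
  rw [← fracDual_jacobianFrac h_ne] at hr
  rw [mul_comm]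
  exact Submodule.mem_div_iff_forall_mul_mem.mp hr _ ⟨y, hy, rfl⟩

theorem restr_derivation_mem_jacobianIdeal (δ : Theta n) : restr h (δ h) ∈ jacobianIdeal h := by
  rw [derivation_apply_eq_sum, map_sum]
  refine sum_mem fun i _ => ?_
  rw [map_mul]
  exact Ideal.mul_mem_left _ _ (Ideal.subset_span ⟨i, rfl⟩)

theorem exists_derivation_of_mem_jacobianIdeal {y : OD h} (hy : y ∈ jacobianIdeal h) :
    ∃ δ : Theta n, restr h (δ h) = y := by
  obtain ⟨c, rfl⟩ := (Submodule.mem_span_range_iff_exists_fun _).mp hy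
  choose c' hc' using fun i => Ideal.Quotient.mk_surjective (c i)
  refine ⟨vectorField c', ?_⟩
  rw [vectorField_apply, map_sum]
  simp only [map_mul, hc', smul_eq_mul]

/-- The map `σ_D` from vector fields to the dual of `𝓡_D`. -/
def dualMap (h_ne : h ≠ 0) : Theta n →ₗ[OS n] (residueModule h →ₗ[OD h] OD h) where
  toFun δ := mulHom (residueModule h) ⟨_, algebraMap_mem_fracDual_residueModule h_ne
    (restr_derivation_mem_jacobianIdeal δ)⟩
  map_add' δ δ' := LinearMap.ext fun r => algebraMap_injective (OD h) (by
    rw [LinearMap.add_apply, map_add, algebraMap_mulHom, algebraMap_mulHom, algebraMap_mulHom]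
    simp only [Derivation.add_apply, map_add, add_mul])
  map_smul' f δ := LinearMap.ext fun r => algebraMap_injective (OD h) (by
    have : ∀ φ : residueModule h →ₗ[OD h] OD h, (f • φ) r = restr h f * φ r := fun φ => by
      rw [LinearMap.smul_apply, Algebra.smul_def]
      rfl
    rw [RingHom.id_apply, this, map_mul, algebraMap_mulHom, algebraMap_mulHom]
    simp only [Derivation.smul_apply, smul_eq_mul, map_mul]
    ring)

theorem algebraMap_dualMap (h_ne : h ≠ 0) (δ : Theta n) (r : residueModule h) :
    algebraMap (OD h) (MD h) (dualMap h_ne δ r) =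
      algebraMap (OD h) (MD h) (restr h (δ h)) * r.1 :=
  algebraMap_mulHom _ _ _

theorem exact_subtype_dualMap (h_ne : h ≠ 0) :
    Function.Exact (logDer h).subtype (dualMap h_ne) := by
  intro δ
  rw [Submodule.coe_subtype, Subtype.range_coe]
  constructor
  · intro h0
    -- Evaluating at the residue `1` recovers `δ h` on `D`.
    have h1 := algebraMap_dualMap h_ne δ ⟨1, one_mem_residueModule h_ne⟩
    rw [h0, LinearMap.zero_apply, map_zero, mul_one] at h1
    exact Ideal.Quotient.eq_zero_iff_mem.mp
      ((map_eq_zero_iff _ (algebraMap_injective (OD h))).mp h1.symm)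
  · intro hδ
    refine LinearMap.ext fun r => algebraMap_injective (OD h) ?_
    rw [algebraMap_dualMap, Ideal.Quotient.eq_zero_iff_mem.mpr hδ]
    simp

theorem mem_jacobianFrac_iff (h_ne : h ≠ 0) (f : MD h) : f ∈ jacobianFrac h ↔
    ∃ hf : f ∈ fracDual (residueModule h),
      mulHom (residueModule h) ⟨f, hf⟩ ∈ Set.range (dualMap h_ne) := by
  constructor
  · rintro ⟨y, hy, rfl⟩
    refine ⟨algebraMap_mem_fracDual_residueModule h_ne hy, ?_⟩
    obtain ⟨δ, rfl⟩ := exists_derivation_of_mem_jacobianIdeal hy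
    exact ⟨δ, rfl⟩
  · rintro ⟨hf, δ, hδ⟩
    have h1 := algebraMap_mulHom (residueModule h) ⟨f, hf⟩ ⟨1, one_mem_residueModule h_ne⟩
    rw [← hδ, algebraMap_dualMap, mul_one, mul_one] at h1
    exact ⟨_, restr_derivation_mem_jacobianIdeal δ, h1⟩

end Residue

/-! ### The connecting map to `Ext¹` -/

section Ext

open CategoryTheory Abelian

variable {n : ℕ} {h : OS n}

/-- The complex `0 → 𝓞_S → 𝓞_S → 𝓞_D → 0`, where the first map is multiplication by `h`. -/
abbrev restrComplex (h : OS n) : ShortComplex (ModuleCat (OS n)) :=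
  ShortComplex.mk (X₁ := ModuleCat.of (OS n) (OS n)) (X₂ := ModuleCat.of (OS n) (OS n))
    (X₃ := ModuleCat.of (OS n) (OD h))
    (h • 𝟙 _) (ModuleCat.ofHom (Algebra.linearMap (OS n) (OD h))) (by
      ext
      simp only [ModuleCat.hom_comp, ModuleCat.hom_smul, ModuleCat.hom_id, ModuleCat.hom_ofHom]
      change algebraMap (OS n) (OD h) (h * 1) = 0
      rw [mul_one]
      exact Ideal.Quotient.eq_zero_iff_mem.mpr (Ideal.mem_span_singleton_self h))

theorem restrComplex_shortExact (h_ne : h ≠ 0) : (restrComplex h).ShortExact where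
  exact := by
    rw [ShortComplex.moduleCat_exact_iff]
    intro (x : OS n) hx
    obtain ⟨a, ha⟩ := Ideal.mem_span_singleton'.mp (Ideal.Quotient.eq_zero_iff_mem.mp hx)
    exact ⟨a, (mul_comm h a).trans ha⟩
  mono_f := by
    rw [ModuleCat.mono_iff_injective]
    exact mul_right_injective₀ h_ne
  epi_g := by
    rw [ModuleCat.epi_iff_surjective]
    exact Ideal.Quotient.mk_surjective (I := Ideal.span {h})

/-- The connecting map `Hom(Ω¹(log D), 𝓞_D) → Ext¹(Ω¹(log D), 𝓞_S)`. -/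
def connecting (h_ne : h ≠ 0) : (logForms h →ₗ[OS n] OD h) →ₗ[OS n]
    Ext (ModuleCat.of (OS n) (logForms h)) (ModuleCat.of (OS n) (OS n)) 1 where
  toFun χ := (Ext.mk₀ (ModuleCat.ofHom χ)).comp (restrComplex_shortExact h_ne).extClass (zero_add 1)
  map_add' χ χ' := by
    rw [ModuleCat.ofHom_add, Ext.mk₀_add, Ext.add_comp]
  map_smul' f χ := by
    rw [RingHom.id_apply, ← Ext.smul_comp, ← Ext.mk₀_smul]
    rfl

theorem connecting_apply (h_ne : h ≠ 0) (χ : logForms h →ₗ[OS n] OD h) : connecting h_ne χ =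
    (Ext.mk₀ (ModuleCat.ofHom χ)).comp (restrComplex_shortExact h_ne).extClass (zero_add 1) :=
  rfl

theorem connecting_eq_zero_iff (h_ne : h ≠ 0) (χ : logForms h →ₗ[OS n] OD h) :
    connecting h_ne χ = 0 ↔ ∃ ψ : logForms h →ₗ[OS n] OS n, ∀ ω, restr h (ψ ω) = χ ω := by
  rw [connecting_apply]
  constructor
  · intro h0
    obtain ⟨x, hx⟩ := Ext.covariant_sequence_exact₃ _ (restrComplex_shortExact h_ne)
      (Ext.mk₀ (ModuleCat.ofHom χ)) (zero_add 1) h0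
    obtain ⟨ψ, rfl⟩ := Ext.homEquiv₀.symm.surjective x
    rw [Ext.homEquiv₀_symm_apply, Ext.mk₀_comp_mk₀] at hx
    have hx' := Ext.homEquiv₀.symm.injective hx
    exact ⟨ψ.hom, fun ω => ConcreteCategory.congr_hom hx' ω⟩
  · rintro ⟨ψ, hψ⟩
    have : ModuleCat.ofHom χ = (ModuleCat.ofHom ψ : _ ⟶ (restrComplex h).X₂) ≫ (restrComplex h).g := by
      ext ω
      exact (hψ ω).symm
    rw [this, ← Ext.mk₀_comp_mk₀, Ext.comp_assoc_of_second_deg_zero,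
      (restrComplex_shortExact h_ne).comp_extClass, Ext.comp_zero]

/-- The next map in the long exact sequence is multiplication by `h` on `Ext¹`, which is zero
because it factors through `Ext¹` of a free module. -/
theorem connecting_surjective (h_ne : h ≠ 0) : Function.Surjective (connecting h_ne) := by
  intro y
  have h0 : y.comp (Ext.mk₀ (restrComplex h).f) (add_zero 1) = 0 := by
    change y.comp (Ext.mk₀ (h • 𝟙 _)) (add_zero 1) = 0
    rw [← Ext.smul_eq_comp_mk₀]
    have h1 : h • y = (Ext.mk₀ (h • 𝟙 (ModuleCat.of (OS n) (logForms h)))).comp y (zero_add 1) := by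
      rw [Ext.mk₀_smul, Ext.smul_comp, Ext.mk₀_id_comp]
    have h2 : h • 𝟙 (ModuleCat.of (OS n) (logForms h)) =
        (ModuleCat.ofHom (numerator h) : _ ⟶ ModuleCat.of (OS n) (Fin n → OS n)) ≫
          ModuleCat.ofHom (holForm h) := by
      exact ModuleCat.hom_ext (LinearMap.ext fun ω => (holForm_numerator ω).symm)
    have : Projective (ModuleCat.of (OS n) (Fin n → OS n)) :=
      ModuleCat.projective_of_free (Pi.basisFun (OS n) (Fin n))
    rw [h1, h2, ← Ext.mk₀_comp_mk₀, Ext.comp_assoc_of_second_deg_zero,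
      Ext.eq_zero_of_projective ((Ext.mk₀ (ModuleCat.ofHom (holForm h))).comp y (zero_add 1)),
      Ext.comp_zero]
  obtain ⟨x, hx⟩ := Ext.covariant_sequence_exact₁ _ (restrComplex_shortExact h_ne) y h0 (zero_add 1)
  obtain ⟨χ, rfl⟩ := Ext.homEquiv₀.symm.surjective x
  exact ⟨χ.hom, hx⟩

/-- Every homomorphism to `𝓞_D` agrees on holomorphic forms with the reduction of a homomorphism
to `𝓞_S`. -/
theorem exists_hom_restr_holForm_eq (h_ne : h ≠ 0) (χ : logForms h →ₗ[OS n] OD h) :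
    ∃ ψ : logForms h →ₗ[OS n] OS n, ∀ b, restr h (ψ (holForm h b)) = χ (holForm h b) := by
  classical
  choose c hc using fun i : Fin n =>
    Ideal.Quotient.mk_surjective (χ (holForm h (Pi.single i 1)))
  have hsum : ∀ b, χ (holForm h b) = restr h (∑ i, b i * c i) := by
    intro b
    conv_lhs => rw [pi_eq_sum_univ' b]
    rw [map_sum, map_sum, map_sum]
    refine Finset.sum_congr rfl fun i _ => ?_
    rw [map_smul, map_smul, map_mul, hc, Algebra.smul_def]
    congr 4
  -- With `a = h ω`, the sum `∑ aᵢ cᵢ` restricts to `χ(h ω) = h χ(ω) = 0` on `D`; the lift is `ω ↦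
  -- h⁻¹ ∑ aᵢ cᵢ`.
  have hdvd : ∀ ω, ∃ a, a * h = ∑ i, numerator h ω i * c i := by
    intro ω
    refine Ideal.mem_span_singleton'.mp (Ideal.Quotient.eq_zero_iff_mem.mp ?_)
    rw [← hsum, holForm_numerator, map_smul, Algebra.smul_def]
    change restr h h * _ = 0
    rw [Ideal.Quotient.eq_zero_iff_mem.mpr (Ideal.mem_span_singleton_self h), zero_mul]
  choose ψ hψ using hdvd
  refine ⟨{ toFun := ψ
            map_add' := fun ω ω' => mul_right_cancel₀ h_ne ?_
            map_smul' := fun f ω => mul_right_cancel₀ h_ne ?_ }, fun b => ?_⟩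
  · rw [add_mul, hψ, hψ, hψ, ← Finset.sum_add_distrib]
    simp [add_mul]
  · rw [RingHom.id_apply, smul_eq_mul, mul_assoc, hψ, hψ, Finset.mul_sum]
    simp [mul_assoc]
  · change restr h (ψ (holForm h b)) = _
    rw [hsum]
    congr 1
    refine mul_right_cancel₀ h_ne ?_
    rw [hψ, numerator_holForm, Finset.sum_mul]
    refine Finset.sum_congr rfl fun i _ => ?_
    rw [Pi.smul_apply, smul_eq_mul]
    ring

/-- Precomposition with the residue map. -/
def precompResidue (ρ : logForms h →ₗ[OS n] residueModule h) :
    (residueModule h →ₗ[OD h] OD h) →ₗ[OS n] (logForms h →ₗ[OS n] OD h) where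
  toFun φ := (φ.restrictScalars (OS n)).comp ρ
  map_add' _ _ := rfl
  map_smul' _ _ := rfl

theorem precompResidue_apply (ρ : logForms h →ₗ[OS n] residueModule h)
    (φ : residueModule h →ₗ[OD h] OD h) (ω : logForms h) :
    precompResidue ρ φ ω = φ (ρ ω) := rfl

variable {ρ : logForms h →ₗ[OS n] residueModule h}

theorem partialD_mul_residue
    (hρ : ∀ (ω : logForms h) (r : MD h), IsResidue h ω.1 r ↔ r = (ρ ω).1) (ω : logForms h)
    (j : Fin n) : algebraMap (OD h) (MD h) (restr h (partialD j h)) * (ρ ω).1 =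
      algebraMap (OD h) (MD h) (restr h (numerator h ω j)) :=
  (isResidue_iff ω _).mp ((hρ ω _).mpr rfl) j

theorem residue_surjective
    (hρ : ∀ (ω : logForms h) (r : MD h), IsResidue h ω.1 r ↔ r = (ρ ω).1) :
    Function.Surjective ρ := by
  rintro ⟨r, ω, hω, hr⟩
  exact ⟨⟨ω, hω⟩, Subtype.ext ((hρ ⟨ω, hω⟩ r).mp hr).symm⟩

theorem residue_holForm (hρ : ∀ (ω : logForms h) (r : MD h), IsResidue h ω.1 r ↔ r = (ρ ω).1)
    (b : Fin n → OS n) : ρ (holForm h b) = 0 := by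
  refine Subtype.ext ((hρ _ 0).mp ((isResidue_iff _ _).mpr fun j => ?_)).symm
  rw [numerator_holForm, Pi.smul_apply, smul_eq_mul, map_mul,
    Ideal.Quotient.eq_zero_iff_mem.mpr (Ideal.mem_span_singleton_self h)]
  simp

theorem exists_holForm_eq_of_residue_eq_zero (h_ne : h ≠ 0)
    (hρ : ∀ (ω : logForms h) (r : MD h), IsResidue h ω.1 r ↔ r = (ρ ω).1)
    {ω : logForms h} (h0 : ρ ω = 0) : ∃ b, holForm h b = ω := by
  have h1 : ∀ j, ∃ b, b * h = numerator h ω j := fun j => by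
    refine Ideal.mem_span_singleton'.mp (Ideal.Quotient.eq_zero_iff_mem.mp ?_)
    refine (map_eq_zero_iff _ (algebraMap_injective (OD h))).mp ?_
    change algebraMap (OD h) (MD h) (restr h _) = 0
    rw [← partialD_mul_residue hρ, h0]
    simp
  choose b hb using h1
  refine ⟨b, numerator_injective h_ne ?_⟩
  rw [numerator_holForm]
  exact funext fun j => by rw [← hb, Pi.smul_apply, smul_eq_mul, mul_comm]

theorem exact_dualMap_connecting (h_ne : h ≠ 0)
    (hρ : ∀ (ω : logForms h) (r : MD h), IsResidue h ω.1 r ↔ r = (ρ ω).1) :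
    Function.Exact (dualMap h_ne) ((connecting h_ne).comp (precompResidue ρ)) := by
  intro φ
  have hval : ∀ (c : Fin n → OS n) (ω : logForms h),
      restr h (∑ i, numerator h ω i * c i) = dualMap h_ne (vectorField c) (ρ ω) := by
    intro c ω
    refine algebraMap_injective (OD h) ?_
    rw [algebraMap_dualMap, vectorField_apply, map_sum, map_sum, map_sum, map_sum, Finset.sum_mul]
    refine Finset.sum_congr rfl fun i _ => ?_
    rw [map_mul, map_mul, map_mul, map_mul, ← partialD_mul_residue hρ]
    ring
  rw [LinearMap.comp_apply, connecting_eq_zero_iff]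
  constructor
  · rintro ⟨ψ, hψ⟩
    -- Residues of holomorphic forms vanish, so `ψ(dxᵢ) = cᵢ h`; then `h ψ(ω) = ψ(∑ aᵢ dxᵢ)` gives
    -- `ψ(ω) = ∑ aᵢ cᵢ`, and the vector field is `∑ cᵢ ∂ᵢ`.
    have h1 : ∀ b, ∃ a, a * h = ψ (holForm h b) := fun b => by
      refine Ideal.mem_span_singleton'.mp (Ideal.Quotient.eq_zero_iff_mem.mp ?_)
      rw [hψ, precompResidue_apply, residue_holForm hρ, map_zero]
    classical
    choose c hc using fun i : Fin n => h1 (Pi.single i 1)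
    refine ⟨vectorField c, LinearMap.ext fun r => ?_⟩
    obtain ⟨ω, rfl⟩ := residue_surjective hρ r
    rw [← hval, ← precompResidue_apply, ← hψ]
    congr 1
    refine mul_left_cancel₀ h_ne ?_
    rw [← smul_eq_mul h (ψ ω), ← map_smul, ← holForm_numerator]
    conv_rhs => rw [pi_eq_sum_univ' (numerator h ω)]
    rw [map_sum, map_sum, Finset.mul_sum]
    refine Finset.sum_congr rfl fun i _ => ?_
    rw [map_smul, map_smul, smul_eq_mul, ← hc]
    ring
  · rintro ⟨δ, rfl⟩
    refine ⟨∑ i, δ (coord i) • (LinearMap.proj i).comp (numerator h), fun ω => ?_⟩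
    have h2 : vectorField (fun i => δ (coord i)) = δ := (derivation_eq_sum δ).symm
    rw [precompResidue_apply]
    conv_rhs => rw [← h2]
    rw [← hval]
    congr 1
    simp [LinearMap.sum_apply, mul_comm]

theorem connecting_precompResidue_surjective (h_ne : h ≠ 0)
    (hρ : ∀ (ω : logForms h) (r : MD h), IsResidue h ω.1 r ↔ r = (ρ ω).1) :
    Function.Surjective ((connecting h_ne).comp (precompResidue ρ)) := by
  intro y
  obtain ⟨χ, rfl⟩ := connecting_surjective h_ne y
  obtain ⟨ψ, hψ⟩ := exists_hom_restr_holForm_eq h_ne χ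
  -- Subtracting a liftable map leaves the class in `Ext¹` unchanged and makes `χ'` vanish on
  -- holomorphic forms, so it factors through the residue.
  let χ' : logForms h →ₗ[OS n] OD h := χ - (Algebra.linearMap (OS n) (OD h)).comp ψ
  have hχ' : connecting h_ne χ' = connecting h_ne χ := by
    have h0 := (connecting_eq_zero_iff h_ne
      ((Algebra.linearMap (OS n) (OD h)).comp ψ)).mpr ⟨ψ, fun ω => rfl⟩
    rw [map_sub, h0, sub_zero]
  have hker : LinearMap.ker ρ ≤ LinearMap.ker χ' := by
    intro ω hω
    obtain ⟨b, rfl⟩ := exists_holForm_eq_of_residue_eq_zero h_ne hρ hω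
    exact sub_eq_zero.mpr (hψ b).symm
  let φ : residueModule h →ₗ[OS n] OD h := ((LinearMap.ker ρ).liftQ χ' hker).comp
    (ρ.quotKerEquivOfSurjective (residue_surjective hρ)).symm.toLinearMap
  have hφ : ∀ ω, φ (ρ ω) = χ' ω := by
    intro ω
    have : (ρ.quotKerEquivOfSurjective (residue_surjective hρ)).symm (ρ ω) =
        Submodule.Quotient.mk ω := by
      rw [LinearEquiv.symm_apply_eq]
      rfl
    simp only [φ, LinearMap.comp_apply, LinearEquiv.coe_coe, this, Submodule.liftQ_apply]
  have hsurj : Function.Surjective (algebraMap (OS n) (OD h)) := Ideal.Quotient.mk_surjective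
  refine ⟨φ.extendScalarsOfSurjective hsurj, ?_⟩
  rw [LinearMap.comp_apply, ← hχ']
  congr 1
  exact LinearMap.ext hφ

end Ext

end LogResidue

end

theorem proposition3p4 (n : ℕ) (h : OS n) (h_ne : h ≠ 0)
    (h_zero : MvPowerSeries.constantCoeff (toSeries n h) = 0) (h_red : IsReduced (OD h)) :
    ∃ ρ : logForms h →ₗ[OS n] residueModule h,
      (∀ (ω : logForms h) (r : MD h), IsResidue h ω.1 r ↔ r = (ρ ω).1) ∧
      ∃ (σ : Theta n →ₗ[OS n] (residueModule h →ₗ[OD h] OD h))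
        (τ : (residueModule h →ₗ[OD h] OD h) →ₗ[OS n]
          CategoryTheory.Abelian.Ext (ModuleCat.of (OS n) (logForms h))
            (ModuleCat.of (OS n) (OS n)) 1),
        Function.Injective (logDer h).subtype ∧
        Function.Exact (logDer h).subtype σ ∧
        Function.Exact σ τ ∧
        Function.Surjective τ ∧
        (∀ (δ : Theta n) (ω : logForms h),
          algebraMap (OD h) (MD h) (σ δ (ρ ω)) =
            algebraMap (OD h) (MD h) (restr h (δ h)) * (ρ ω).1) ∧
        IsFracIdeal (jacobianFrac h) ∧
        IsFracIdeal (residueModule h) ∧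
        Function.Bijective (mulHom (residueModule h)) ∧
        Function.Bijective (mulHom (jacobianFrac h)) ∧
        (∀ f : MD h, f ∈ jacobianFrac h ↔
          ∃ hf : f ∈ fracDual (residueModule h), mulHom (residueModule h) ⟨f, hf⟩ ∈ Set.range σ) ∧
        fracDual (jacobianFrac h) = residueModule h := by
  obtain ⟨ρ, hρ⟩ := exists_residueMap h_ne h_red
  obtain ⟨x, hx, hx'⟩ := exists_mem_jacobianFrac_nonZeroDivisors h_ne h_red
  exact ⟨ρ, hρ, dualMap h_ne, (connecting h_ne).comp (precompResidue ρ),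
    (logDer h).subtype_injective, exact_subtype_dualMap h_ne, exact_dualMap_connecting h_ne hρ,
    connecting_precompResidue_surjective h_ne hρ, fun δ ω => algebraMap_dualMap h_ne δ (ρ ω),
    isFracIdeal_jacobianFrac h_ne h_red, isFracIdeal_residueModule h_ne h_red,
    mulHom_bijective (one_mem_residueModule h_ne) (one_mem _), mulHom_bijective hx hx',
    mem_jacobianFrac_iff h_ne, fracDual_jacobianFrac h_ne⟩
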